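/- **Setting.** Let $\operatorname{Lip}[0;1]$ be the set of Lipschitz-continuous $f:[0;1]\to\mathbb{R}$. A string function $\psi:\{0,1\}^*\to\{0,1\}^*$ is *length-monotone* if $|v|\le|w|$ implies $|\psi(v)|\le|\psi(w)|$; then $|\psi|:\mathbb{N}\to\mathbb{N}$, $|w|\mapsto|\psi(w)|$, denotes its length. * A *$\rho_{\mathrm{dy}}$-name* of $x\in\mathbb{R}$ is an infinite binary string encoding (concatenating self-delimited canonical binary numerals) a sequence $(a_n)_{n\in\mathbb N}$ of integers with $|x-a_n/2^{n+1}|\le 2^{-n}$ for all $n$. * A *$\rho_{\mathrm{dy}}^{\mathbb D}$-name* of $f:[0;1]\to\mathbb{R}$ is a length-monotone $\psi$ such that, for every word $w$ of length $m$, read as a binary numeral denoting the dyadic number $a\in[0;1)$, $a=w/2^m$, the word $\psi(w)$ encodes (sign bit and binary numeral, leading zeros allowed) an integer $z$ with $|z/2^{m+1}-f(x)|\le2^{-m}$ for some $x\in[0;1]$ with $|x-a|<2^{-m}$. * A *$(\rho_{\mathrm{dy}}^{\mathbb D}+\operatorname{binary}(\operatorname{Lip}))$-name* of $f$ is a map $w\mapsto\langle\operatorname{bin}(\ell),\psi(w)\rangle$,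 where $\psi$ is a $\rho_{\mathrm{dy}}^{\mathbb D}$-name of $f$, $\ell\in\mathbb{N}$ is a Lipschitz constant of $f$, and $\langle u,v\rangle$ is a self-delimiting code of $u$ followed by $v$. * A *$[\widetilde{\rho_{\mathrm{dy}}\to\rho_{\mathrm{dy}}}]$-name* of $f$ is a length-monotone map $w\mapsto 1^{\mu(|w|)}\,0\,\psi(w)$, where $\psi$ is a $\rho_{\mathrm{dy}}^{\mathbb D}$-name of $f$ and $\mu:\mathbb N\to\mathbb N$ is a modulus of continuity: $|x-y|\le2^{-\mu(n)}$ implies $|f(x)-f(y)|\le2^{-n}$. An oracle Type-2 machine is a Turing machine with a one-way input tape, a one-way output tape, work tapes, and a query tape whose content $w$ is replaced by $\psi(w)$ when the oracle $\psi$ is called. For a class $\mathcal F\subseteq\operatorname{Lip}[0;1]$, an operator $\Lambda:\mathcal F\times[0;1]^2\to\mathbb{R}$ is *computable* if some such machine, given any $(\rho_{\mathrm{dy}}^{\mathbb D}+\operatorname{binary}(\operatorname{Lip}))$-name $\varphi$ of any $f\in\mathcal F$ as oracle and any (interleaved) $\rho_{\mathrm{dy}}$-names of any $u,v\in[0;1]$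 as input, writes a $\rho_{\mathrm{dy}}$-name of $\Lambda(f,u,v)$. It is computable *in time* $T:\mathbb N\times\mathbb N^{\mathbb N}\to\mathbb N$ if moreover, for every $n$, the approximations $a_0,\dots,a_n$ (hence one up to error $2^{-n}$) have been written within $T(n,|\varphi|)$ steps. Call $T$ *subexponential* if for every fixed $k\in\mathbb N$, $T(n,\,m\mapsto m+k)\le2^{o(n)}$ as $n\to\infty$. **Statement.** 1. Parametric maximization $$\operatorname{MAX}:(f,u,v)\mapsto\max\{f(x):\min(u,v)\le x\le\max(u,v)\}$$ is computable on $\operatorname{Lip}[0;1]\times[0;1]^2$. 2. $\operatorname{MAX}$ is not computable in any subexponential time, even restricted to $f:[0;1]\to[0;1]$ that are 1-Lipschitz and analytic, i.e. that extend to a complex differentiable function on an open complex neighbourhood of $[0;1]$. 3. Parametric integration $$\textstyle\int:(f,u,v)\mapsto\int_{\min(u,v)}^{\max(u,v)}f(x)\,dx$$ is computable on $\operatorname{Lip}[0;1]\times[0;1]^2$; but not in any subexponential time, even restricted to 1-Lipschitz $f:[0;1]\to[0;1]$ that extend to a complex differentiable function on an open neighbourhood of the closed complex unit disc. 4. The restriction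 of $[\widetilde{\rho_{\mathrm{dy}}\to\rho_{\mathrm{dy}}}]$ to $\operatorname{Lip}[0;1]$ is not computably reducible to $\rho_{\mathrm{dy}}^{\mathbb D}+\operatorname{binary}(\operatorname{Lip})$: no oracle machine, given any $[\widetilde{\rho_{\mathrm{dy}}\to\rho_{\mathrm{dy}}}]$-name of any $f\in\operatorname{Lip}[0;1]$ as oracle, computes (on input $v$, printing the value at $v$ and halting) a $(\rho_{\mathrm{dy}}^{\mathbb D}+\operatorname{binary}(\operatorname{Lip}))$-name of $f$. -/

import Mathlib

open Set Filter Topology MeasureTheory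
open scoped NNReal unitInterval

/-! ## Binary words, integers, and codes -/

/-- `bin z`: the canonical binary code of an integer. For `z ≥ 1` it is the usual binary numeral
(most significant bit first, hence with leading `1`); for `z ≤ 0` it is `0 w` where `1 w` is the
binary numeral of `1 - z`. This is a bijection from `ℤ` onto the nonempty words. -/
def bin (z : ℤ) : List Bool :=
  if 0 < z then (Nat.bits z.toNat).reverse
  else false :: (Nat.bits (1 - z).toNat).reverse.tail

/-- The natural number denoted by a word read as a binary numeral, most significant bit first,
leading zeros allowed. -/
def natVal (w : List Bool) : ℕ := w.foldl (fun n b => Nat.bit b n) 0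

/-- The integer denoted by a word consisting of a sign bit (`1` for plus, `0` for minus) and a
binary numeral, leading zeros allowed, so that every integer has codes of all large lengths. -/
def intVal : List Bool → ℤ
  | [] => 0
  | true :: w => natVal w
  | false :: w => -(natVal w : ℤ)

/-- Self-delimiting code `1 w₁ 1 w₂ … 1 wₙ 0` of a word. -/
def selfDelim (w : List Bool) : List Bool := w.flatMap (fun b => [true, b]) ++ [false]

/-- The pairing `⟨u, v⟩` of words. -/
def pairWord (u v : List Bool) : List Bool := selfDelim u ++ v

/-! ## The representation of real numbers by dyadic approximations -/

/-- The concatenated self-delimiting codes of `a 0, …, a (n - 1)`. -/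
def seqCode (a : ℕ → ℤ) (n : ℕ) : List Bool :=
  (List.range n).flatMap fun i => selfDelim (bin (a i))

/-- The infinite binary string `p` encodes the integer sequence `a`. -/
def EncodesSeq (p : ℕ → Bool) (a : ℕ → ℤ) : Prop :=
  ∀ n, seqCode a n = (List.range (seqCode a n).length).map p

/-- `a` is a sequence of numerators of dyadic approximations to `x`: `|x - aₙ/2ⁿ⁺¹| ≤ 2⁻ⁿ`. -/
def DyadicApprox (a : ℕ → ℤ) (x : ℝ) : Prop :=
  ∀ n : ℕ, |x - (a n : ℝ) / 2 ^ (n + 1)| ≤ (2 ^ n : ℝ)⁻¹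

/-- `p` is a `ρ_dy`-name of the real number `x`. -/
def IsRealName (p : ℕ → Bool) (x : ℝ) : Prop :=
  ∃ a : ℕ → ℤ, EncodesSeq p a ∧ DyadicApprox a x

/-- The infinite string `p₀ q₀ p₁ q₁ …` -/
def interleave (p q : ℕ → Bool) (i : ℕ) : Bool :=
  if i % 2 = 0 then p (i / 2) else q (i / 2)

/-! ## Second-order names of functions on the unit interval -/

/-- A string function is length-monotone: `|v| ≤ |w|` implies `|ψ v| ≤ |ψ w|`. -/
def LengthMonotone (ψ : List Bool → List Bool) : Prop :=
  ∀ v w : List Bool, v.length ≤ w.length → (ψ v).length ≤ (ψ w).length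

/-- The length `|ψ| : ℕ → ℕ` of a length-monotone string function. -/
def strLen (ψ : List Bool → List Bool) (n : ℕ) : ℕ := (ψ (List.replicate n false)).length

/-- `ψ` is a name of `f` by approximate values at dyadic arguments: on a word `w` of length `m`,
denoting the argument `a = natVal w / 2ᵐ ∈ [0;1)`, the answer is (a code, padded with leading zeros,
of) an integer `z` with `|z/2ᵐ⁺¹ - f x| ≤ 2⁻ᵐ` for some `x ∈ [0;1]` with `|x - a| < 2⁻ᵐ`. -/
def IsDyadicFunName (ψ : List Bool → List Bool) (f : I → ℝ) : Prop :=
  LengthMonotone ψ ∧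
  ∀ w : List Bool, ∃ x : I,
    |(x : ℝ) - (natVal w : ℝ) / 2 ^ w.length| < (2 ^ w.length : ℝ)⁻¹ ∧
    |(intVal (ψ w) : ℝ) / 2 ^ (w.length + 1) - f x| ≤ (2 ^ w.length : ℝ)⁻¹

/-- A name of `f` with an integer Lipschitz constant `ℓ` in binary: `w ↦ ⟨bin ℓ, ψ w⟩`. -/
def IsLipName (φ : List Bool → List Bool) (f : I → ℝ) : Prop :=
  ∃ (l : ℕ) (ψ : List Bool → List Bool),
    LipschitzWith (l : ℝ≥0) f ∧ IsDyadicFunName ψ f ∧ ∀ w, φ w = pairWord (bin (l : ℤ)) (ψ w)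

/-- `μ` is a modulus of uniform continuity of `f`. -/
def IsModulus (μ : ℕ → ℕ) (f : I → ℝ) : Prop :=
  ∀ (n : ℕ) (x y : I), |(x : ℝ) - y| ≤ (2 ^ μ n : ℝ)⁻¹ → |f x - f y| ≤ (2 ^ n : ℝ)⁻¹

/-- A name of `f` with a modulus of continuity `μ`: the length-monotone string function
`w ↦ 1^{μ(|w|)} 0 ψ(w)`. -/
def IsModulusName (φ : List Bool → List Bool) (f : I → ℝ) : Prop :=
  LengthMonotone φ ∧
  ∃ (μ : ℕ → ℕ) (ψ : List Bool → List Bool),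
    IsModulus μ f ∧ IsDyadicFunName ψ f ∧
      ∀ w, φ w = List.replicate (μ w.length) true ++ false :: ψ w

/-! ## Oracle Type-2 machines -/

/-- The instruction attached to a label: a statement on the finitely many work stacks, or an access
to the input tape, the query tape or the output tape (each of these costs one step). -/
inductive OracleInstr (K : Type) (Γ : K → Type) (Λ S : Type) : Type
  /-- execute one statement of a multi-stack Turing machine -/
  | work (s : Turing.TM2.Stmt Γ Λ S)
  /-- read the next cell (a bit or a blank) of the one-way read-only input tape -/
  | readInput (f : S → Option Bool → S) (next : Λ)
  /-- write the next bit on the one-way write-only output tape -/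
  | writeOutput (b : S → Bool) (next : Λ)
  /-- write a bit in front of the query tape content -/
  | pushQuery (b : S → Bool) (next : Λ)
  /-- read and remove the first bit of the query tape content -/
  | popQuery (f : S → Option Bool → S) (next : Λ)
  /-- erase the query tape -/
  | clearQuery (next : Λ)
  /-- replace the query tape content `w` by the oracle answer `ψ w` -/
  | ask (next : Λ)

/-- A Type-2 Turing machine with a query tape for a string function oracle: a finite control (labels
`Λ` and internal states `S`), finitely many work stacks over finite alphabets (two stacks make up a
work tape), a one-way input tape, a one-way output tape, and a query tape. -/
structure OracleMachine where
  K : Type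
  [decEqK : DecidableEq K]
  [finK : Fintype K]
  Γ : K → Type
  [finΓ : ∀ k, Fintype (Γ k)]
  Λ : Type
  [finΛ : Fintype Λ]
  S : Type
  [finS : Fintype S]
  main : Λ
  start : S
  prog : Λ → OracleInstr K Γ Λ S

namespace OracleMachine

/-- A configuration: label (`none` if halted), internal state, work stacks, position on the input
tape, contents of the query tape and of the output tape. -/
structure Cfg (M : OracleMachine) where
  label : Option M.Λ
  var : M.S
  stk : ∀ k, List (M.Γ k)
  pos : ℕ
  query : List Bool
  output : List Bool

/-- The initial configuration: empty work stacks, empty query tape, empty output tape. -/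
def initCfg (M : OracleMachine) : M.Cfg :=
  ⟨some M.main, M.start, fun _ => [], 0, [], []⟩

/-- One step of the machine with oracle `ψ` and input tape `inp`. -/
def step (M : OracleMachine) (ψ : List Bool → List Bool) (inp : ℕ → Option Bool) (c : M.Cfg) :
    M.Cfg :=
  match c.label with
  | none => c
  | some l =>
    match M.prog l with
    | .work s =>
      let d := letI := M.decEqK; Turing.TM2.stepAux s c.var c.stk
      { c with label := d.l, var := d.var, stk := d.stk }
    | .readInput f next => { c with label := some next, var := f c.var (inp c.pos), pos := c.pos + 1 }
    | .writeOutput b next => { c with label := some next, output := c.output ++ [b c.var] }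
    | .pushQuery b next => { c with label := some next, query := b c.var :: c.query }
    | .popQuery f next =>
      { c with label := some next, var := f c.var c.query.head?, query := c.query.tail }
    | .clearQuery next => { c with label := some next, query := [] }
    | .ask next => { c with label := some next, query := ψ c.query }

/-- The configuration after `t` steps. -/
def run (M : OracleMachine) (ψ : List Bool → List Bool) (inp : ℕ → Option Bool) (t : ℕ) : M.Cfg :=
  (M.step ψ inp)^[t] M.initCfg

/-- With oracle `ψ` and the infinite input string `p`, the machine writes the infinite string `τ`. -/
def Produces (M : OracleMachine) (ψ : List Bool → List Bool) (p τ : ℕ → Bool) : Prop :=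
  (∀ t, (M.run ψ (fun i => some (p i)) t).output =
    (List.range (M.run ψ (fun i => some (p i)) t).output.length).map τ) ∧
  ∀ n, ∃ t, n ≤ (M.run ψ (fun i => some (p i)) t).output.length

/-- With oracle `ψ` and the finite input word `v`, the machine halts with the word `w` as output. -/
def Outputs (M : OracleMachine) (ψ : List Bool → List Bool) (v w : List Bool) : Prop :=
  ∃ t, (M.run ψ (fun i => v[i]?) t).label = none ∧ (M.run ψ (fun i => v[i]?) t).output = w

end OracleMachine

/-! ## Computability and complexity of operators `(f, u, v) ↦ op f u v` -/

/-- The operator `op`, restricted to functions `f ∈ F`, is computable: some oracle machine, given any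
Lipschitz name of any `f ∈ F` as oracle and any `ρ_dy`-names of `u, v ∈ [0;1]`, interleaved, as
input, writes a `ρ_dy`-name of `op f u v`. -/
def ComputableOperator (F : Set (I → ℝ)) (op : (I → ℝ) → I → I → ℝ) : Prop :=
  ∃ M : OracleMachine, ∀ f ∈ F, ∀ u v : I, ∀ (φ : List Bool → List Bool) (p q : ℕ → Bool),
    IsLipName φ f → IsRealName p u → IsRealName q v →
    ∃ τ : ℕ → Bool, M.Produces φ (interleave p q) τ ∧ IsRealName τ (op f u v)

/-- The same with a running time bound `T`, in terms of the output precision `n` and the length `|φ|`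
of the oracle: for every `n`, the first `T(n, |φ|)` steps suffice to write the (codes of the)
numerators `a 0, …, a n` of the approximations up to error `2⁻ⁿ`. -/
def ComputableOperatorInTime (F : Set (I → ℝ)) (op : (I → ℝ) → I → I → ℝ)
    (T : ℕ → (ℕ → ℕ) → ℕ) : Prop :=
  ∃ M : OracleMachine, ∀ f ∈ F, ∀ u v : I, ∀ (φ : List Bool → List Bool) (p q : ℕ → Bool),
    IsLipName φ f → IsRealName p u → IsRealName q v →
    ∃ (τ : ℕ → Bool) (a : ℕ → ℤ), M.Produces φ (interleave p q) τ ∧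
      EncodesSeq τ a ∧ DyadicApprox a (op f u v) ∧
      ∀ n, (seqCode a (n + 1)).length ≤
        (M.run φ (fun i => some (interleave p q i)) (T n (strLen φ))).output.length

/-- A second-order time bound is subexponential if, on oracles of length `|φ|(m) = m + k` with any
fixed `k`, it is `2^{o(n)}`. -/
def Subexponential (T : ℕ → (ℕ → ℕ) → ℕ) : Prop :=
  ∀ (k : ℕ) (ε : ℝ), 0 < ε → ∀ᶠ n : ℕ in atTop, (T n (fun m => m + k) : ℝ) ≤ 2 ^ (ε * n)

/-- Computable reducibility of one second-order representation (given by its name relation `N₁`) to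
another (`N₂`) on a space `X` of functions: some oracle machine, given any `N₁`-name of any `f ∈ X`
as oracle, computes an `N₂`-name of `f`, word by word. -/
def ReducesTo (X : Set (I → ℝ)) (N₁ N₂ : (List Bool → List Bool) → (I → ℝ) → Prop) : Prop :=
  ∃ M : OracleMachine, ∀ f ∈ X, ∀ φ, N₁ φ f →
    ∃ φ' : List Bool → List Bool, N₂ φ' f ∧ ∀ v, M.Outputs φ v (φ' v)

/-! ## The function classes and the operators -/

/-- `Lip[0;1]`: the Lipschitz functions on the unit interval. -/
def LipFun : Set (I → ℝ) := {f | ∃ l : ℝ≥0, LipschitzWith l f}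

/-- The 1-Lipschitz functions `[0;1] → [0;1]`. -/
def LipOneUnit : Set (I → ℝ) := {f | LipschitzWith 1 f ∧ ∀ x, f x ∈ Icc (0 : ℝ) 1}

/-- The real functions on `[0;1]` that extend to a complex differentiable function on some open
superset of `A` (where `[0;1] ⊆ A ⊆ ℂ`). -/
def HolomorphicOn (A : Set ℂ) : Set (I → ℝ) :=
  {f | ∃ (U : Set ℂ) (g : ℂ → ℂ), IsOpen U ∧ A ⊆ U ∧ DifferentiableOn ℂ g U ∧
    ∀ x : I, g ((x : ℝ) : ℂ) = (f x : ℂ)}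

/-- `[0;1]` as a subset of the complex plane. -/
def unitSegment : Set ℂ := (fun x : ℝ => (x : ℂ)) '' Icc (0 : ℝ) 1

/-- Parametric maximization `max {f x : min(u,v) ≤ x ≤ max(u,v)}`. -/
noncomputable def parMax (f : I → ℝ) (u v : I) : ℝ := sSup (f '' Icc (min u v) (max u v))

/-- For continuous `f` the supremum in `parMax` is attained. -/
theorem isGreatest_parMax {f : I → ℝ} (hf : Continuous f) (u v : I) :
    IsGreatest (f '' Icc (min u v) (max u v)) (parMax f u v) :=
  (isCompact_Icc.image hf).isGreatest_sSup ((nonempty_Icc.2 min_le_max).image f)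

/-- Parametric integration `∫ f(x) dx` from `min(u,v)` to `max(u,v)`. -/
noncomputable def parInt (f : I → ℝ) (u v : I) : ℝ :=
  ∫ x in (min (u : ℝ) v)..(max (u : ℝ) v), IccExtend zero_le_one f x

/-! ## Words and codes -/

/-! Lower bounds come from an adversary argument (`not_computableOperatorInTime`). In `S` steps a
machine sees the oracle on at most `S` words, of length at most `6 * S` for the names used here.
Feed it the name of the zero function that rounds values down. One of `S + 1` equidistant points,
`c`, is at distance at least `1/(2(S+1))` from all queried points (`exists_far_point`). The Gaussian
`bump N c` with `N ≥ 24(S+1)³` has decayed below the queried resolution there (`bump_lt_of_far`), so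
its rounded name gives the same answers and the machine behaves identically
(`OracleMachine.run_congr`). The bump has height `1/(2N)`, which makes it 1-Lipschitz; it is entire,
yet raises maximum and integral from `0` to at least `1/(8N²)`. This is polynomial in `1/S` when `N`
is, hence larger than `2 · 2⁻ⁿ` for some `n` if `S` is subexponential.

The failure of the reduction has the same source. A ramp of slope `K` and tiny height `h` is
invisible to finitely many queries, and all ramps with `h * K ≤ 1` share the modulus `2n`. A machine
that prints the Lipschitz constant `l` for zero therefore prints `l` for a ramp of slope `l + 1`
too.

Computability has an analytic and a machine half. Analytically, the oracle's answer to the empty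
word yields a Lipschitz constant and a bound for `|f|`. These determine a precision `k` at which a
table of `2 ^ k` approximate values suffices to find the maximum or the integral
(`computableOperator_of_table`). For the machine half, a program with primitive recursive control
gathers ever longer pieces of both inputs and ever more oracle answers, and writes the next
numerator as soon as the data determine it (`computableOperator_of_approx`). Such a program becomes
an oracle machine by running a compiled code for its control function in a loop, with one tape
access per round (`exists_oracleMachine`). -/

theorem natVal_append_singleton (w : List Bool) (b : Bool) :
    natVal (w ++ [b]) = Nat.bit b (natVal w) := by
  simp [natVal]

theorem natVal_cons (b : Bool) (w : List Bool) :
    natVal (b :: w) = b.toNat * 2 ^ w.length + natVal w := by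
  induction w using List.reverseRecOn with
  | nil => cases b <;> rfl
  | append_singleton w c ih =>
    rw [← List.cons_append, natVal_append_singleton, natVal_append_singleton, ih]
    simp only [Nat.bit_val, List.length_append, List.length_singleton, pow_succ]
    ring

theorem natVal_lt (w : List Bool) : natVal w < 2 ^ w.length := by
  induction w with
  | nil => simp [natVal]
  | cons b w ih =>
    rw [natVal_cons, List.length_cons, pow_succ]
    cases b <;> simp <;> omega

theorem natVal_reverse_bits (n : ℕ) : natVal (Nat.bits n).reverse = n := by
  induction n using Nat.binaryRec' with
  | zero => simp [natVal]
  | bit b n h ih => rw [Nat.bits_append_bit _ _ h, List.reverse_cons, natVal_append_singleton, ih]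

theorem exists_reverse_bits_eq_cons {n : ℕ} (hn : n ≠ 0) : ∃ w, (Nat.bits n).reverse = true :: w := by
  induction n using Nat.binaryRec' with
  | zero => exact absurd rfl hn
  | bit b n h ih =>
    rw [Nat.bits_append_bit _ _ h, List.reverse_cons]
    rcases eq_or_ne n 0 with rfl | h0
    · simp [h rfl]
    · obtain ⟨w, hw⟩ := ih h0
      exact ⟨w ++ [b], by rw [hw]; rfl⟩

/-- The integer with the canonical code `w`. -/
def binVal (w : List Bool) : ℤ :=
  if w.head? = some true then natVal w else 1 - natVal (true :: w.tail)

theorem binVal_bin (z : ℤ) : binVal (bin z) = z := by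
  unfold bin
  split_ifs with hz
  · obtain ⟨w, hw⟩ := exists_reverse_bits_eq_cons (n := z.toNat) (by omega)
    have h := natVal_reverse_bits z.toNat
    rw [hw] at h ⊢
    simp only [binVal, List.head?_cons, if_true, h]
    omega
  · obtain ⟨w, hw⟩ := exists_reverse_bits_eq_cons (n := (1 - z).toNat) (by omega)
    have h := natVal_reverse_bits (1 - z).toNat
    rw [hw] at h ⊢
    simp [binVal, h]
    omega

theorem bin_injective : Function.Injective bin := Function.LeftInverse.injective binVal_bin

/-- The nonnegative part of the integer with the canonical code `w`. -/
def binNat (w : List Bool) : ℕ := if w.head? = some true then natVal w else 0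

theorem binNat_bin (z : ℤ) : binNat (bin z) = z.toNat := by
  have h := binVal_bin z
  unfold binVal at h
  unfold binNat
  split_ifs at h ⊢ with h1
  · omega
  · have := natVal_cons true (bin z).tail
    have := Nat.one_le_two_pow (n := (bin z).tail.length)
    simp at *
    omega

/-! ## Decoding concatenations of self-delimiting codes -/

/-- One step of the automaton that splits a string into self-delimited words: the state consists of
a flag (the next bit is a data bit), the current word, and the words completed so far. -/
def scanStep (s : Bool × List Bool × List (List Bool)) (b : Bool) :
    Bool × List Bool × List (List Bool) :=
  if s.1 then (false, s.2.1 ++ [b], s.2.2)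
  else if b then (true, s.2.1, s.2.2)
  else (false, [], s.2.2 ++ [s.2.1])

/-- The complete self-delimited words at the beginning of a string. -/
def scan (w : List Bool) : List (List Bool) := (w.foldl scanStep (false, [], [])).2.2

theorem foldl_scanStep_selfDelim (u c : List Bool) (d : List (List Bool)) :
    (selfDelim u).foldl scanStep (false, c, d) = (false, [], d ++ [c ++ u]) := by
  unfold selfDelim
  induction u generalizing c with
  | nil => simp [scanStep]
  | cons b u ih =>
    simp only [List.flatMap_cons, List.cons_append, List.nil_append, List.foldl_cons]
    have : scanStep (scanStep (false, c, d) true) b = (false, c ++ [b], d) := by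
      simp [scanStep]
    rw [this, ih]
    simp

theorem seqCode_succ (a : ℕ → ℤ) (n : ℕ) :
    seqCode a (n + 1) = seqCode a n ++ selfDelim (bin (a n)) := by
  simp [seqCode, List.range_succ]

theorem foldl_scanStep_seqCode (a : ℕ → ℤ) (n : ℕ) :
    (seqCode a n).foldl scanStep (false, [], []) =
      (false, [], (List.range n).map fun i => bin (a i)) := by
  induction n with
  | zero => rfl
  | succ n ih => rw [seqCode_succ, List.foldl_append, ih, foldl_scanStep_selfDelim]; simp [List.range_succ]

theorem prefix_foldl_scanStep (w : List Bool) (s : Bool × List Bool × List (List Bool)) :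
    s.2.2 <+: (w.foldl scanStep s).2.2 := by
  induction w generalizing s with
  | nil => exact List.prefix_rfl
  | cons b w ih =>
    refine List.IsPrefix.trans ?_ (ih _)
    unfold scanStep
    split_ifs <;> simp

/-- Completed words are never revised when more bits arrive. Hence finite pieces of tapes can be
decoded before the rest is known. -/
theorem scan_mono {v w : List Bool} (h : v <+: w) : scan v <+: scan w := by
  obtain ⟨u, rfl⟩ := h
  unfold scan
  rw [List.foldl_append]
  exact prefix_foldl_scanStep _ _

theorem scan_seqCode (a : ℕ → ℤ) (n : ℕ) :
    scan (seqCode a n) = (List.range n).map fun i => bin (a i) := by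
  rw [scan, foldl_scanStep_seqCode]

theorem head?_scan_pairWord (u v : List Bool) : (scan (pairWord u v)).head? = some u := by
  have h := scan_mono (List.prefix_append (selfDelim u) v)
  rw [scan, foldl_scanStep_selfDelim] at h
  obtain ⟨t, ht⟩ := h
  rw [pairWord, ← ht]
  rfl

theorem le_length_seqCode (a : ℕ → ℤ) (n : ℕ) : n ≤ (seqCode a n).length := by
  induction n with
  | zero => simp
  | succ n ih => rw [seqCode_succ, List.length_append, selfDelim]; simp; omega

/-- A finite string that starts with the codes of two integer sequences determines the coded
entries. -/
theorem eq_of_seqCode_prefix {a b : ℕ → ℤ} {n : ℕ} {s : List Bool} (ha : seqCode a (n + 1) <+: s)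
    (hb : seqCode b (n + 1) <+: s) : a n = b n := by
  have h1 := scan_mono ha
  have h2 := scan_mono hb
  rw [scan_seqCode] at h1 h2
  have h := (List.prefix_of_prefix_length_le h1 h2 (by simp)).eq_of_length (by simp)
  have := congrArg (fun l => l[n]?) h
  simp at this
  exact bin_injective this

theorem selfDelim_length (w : List Bool) : (selfDelim w).length = 2 * w.length + 1 := by
  unfold selfDelim
  induction w with
  | nil => rfl
  | cons b w ih => simp at ih ⊢; omega

/-! ## Words of given length and value -/

/-- The word of length `k` that denotes `i` modulo `2 ^ k`. -/
def wordOf : ℕ → ℕ → List Bool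
  | 0, _ => []
  | k + 1, i => wordOf k (i / 2) ++ [i % 2 == 1]

theorem length_wordOf (k i : ℕ) : (wordOf k i).length = k := by
  induction k generalizing i with
  | zero => rfl
  | succ k ih => simp [wordOf, ih]

theorem natVal_wordOf {k i : ℕ} (h : i < 2 ^ k) : natVal (wordOf k i) = i := by
  induction k generalizing i with
  | zero => simp at h; subst h; rfl
  | succ k ih =>
    rw [wordOf, natVal_append_singleton, ih (by rw [pow_succ] at h; omega), Nat.bit_val]
    rcases Nat.mod_two_eq_zero_or_one i with h | h <;> simp [h] <;> omega

/-! ## A machine depends only on the oracle answers it sees -/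

namespace OracleMachine

variable (M : OracleMachine)

theorem run_succ (ψ : List Bool → List Bool) (inp : ℕ → Option Bool) (t : ℕ) :
    M.run ψ inp (t + 1) = M.step ψ inp (M.run ψ inp t) :=
  Function.iterate_succ_apply' _ _ _

theorem step_congr {ψ ψ' : List Bool → List Bool} (inp : ℕ → Option Bool) {c : M.Cfg}
    (h : ψ c.query = ψ' c.query) : M.step ψ inp c = M.step ψ' inp c := by
  unfold step
  split
  · rfl
  · split <;> simp [h]

/-- The engine of both adversary arguments. Agreement is required on the query tape content at every
time, asked or not; this still concerns only `T` words and avoids tracking when the oracle is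
called. -/
theorem run_congr {ψ ψ' : List Bool → List Bool} (inp : ℕ → Option Bool) {T : ℕ}
    (h : ∀ t < T, ψ (M.run ψ inp t).query = ψ' (M.run ψ inp t).query) {t : ℕ} (ht : t ≤ T) :
    M.run ψ' inp t = M.run ψ inp t := by
  induction t with
  | zero => rfl
  | succ t ih =>
    rw [run_succ, run_succ, ih (by omega)]
    exact (M.step_congr inp (h t ht)).symm

/-- A push adds one bit and an oracle call at most `k`. The query length limits the resolution at
which a function can be inspected. -/
theorem length_query_run_le {ψ : List Bool → List Bool} (inp : ℕ → Option Bool) {k : ℕ}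
    (hk : 1 ≤ k) (h : ∀ w, (ψ w).length ≤ w.length + k) (t : ℕ) :
    (M.run ψ inp t).query.length ≤ k * t := by
  induction t with
  | zero => simp [run, initCfg]
  | succ t ih =>
    have hs : (M.step ψ inp (M.run ψ inp t)).query.length ≤ (M.run ψ inp t).query.length + k := by
      unfold step
      split
      · simp
      · split <;> simp <;> first | omega | exact h _
    rw [run_succ, Nat.mul_succ]
    omega

theorem run_eq_of_halted {ψ : List Bool → List Bool} {inp : ℕ → Option Bool} {t s : ℕ}
    (h : (M.run ψ inp t).label = none) (hs : t ≤ s) : M.run ψ inp s = M.run ψ inp t := by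
  induction s, hs using Nat.le_induction with
  | base => rfl
  | succ s _ ih =>
    rw [run_succ, ih]
    unfold step
    rw [h]

theorem Outputs.unique {M : OracleMachine} {ψ : List Bool → List Bool} {v w w' : List Bool}
    (h : M.Outputs ψ v w) (h' : M.Outputs ψ v w') : w = w' := by
  obtain ⟨t, ht, rfl⟩ := h
  obtain ⟨t', ht', rfl⟩ := h'
  rw [← M.run_eq_of_halted ht (le_max_left t t'), ← M.run_eq_of_halted ht' (le_max_right t t')]

end OracleMachine

/-! ## Names of reals and functions -/

theorem seqCode_prefix (a : ℕ → ℤ) {m n : ℕ} (h : m ≤ n) : seqCode a m <+: seqCode a n := by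
  induction n, h using Nat.le_induction with
  | base => exact List.prefix_rfl
  | succ n _ ih => rw [seqCode_succ]; exact ih.trans (List.prefix_append _ _)

theorem exists_encodesSeq (a : ℕ → ℤ) : ∃ p, EncodesSeq p a := by
  -- Every code has at least one bit, so position `i` lies within the codes of the first `i + 1`
  -- entries and the default `false` is never used.
  refine ⟨fun i => (seqCode a (i + 1)).getD i false, fun n => List.ext_getElem (by simp) ?_⟩
  intro i h1 h2
  have h3 : i < (seqCode a (i + 1)).length := le_length_seqCode a (i + 1)
  simp only [List.getElem_map, List.getElem_range, List.getD_eq_getElem _ _ h3]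
  rcases le_total n (i + 1) with h | h
  · exact (seqCode_prefix a h).getElem h1
  · exact ((seqCode_prefix a h).getElem h3).symm

theorem exists_isRealName_zero : ∃ p, IsRealName p 0 := by
  obtain ⟨p, hp⟩ := exists_encodesSeq 0
  exact ⟨p, 0, hp, fun n => by simp⟩

theorem exists_isRealName_one : ∃ p, IsRealName p 1 := by
  obtain ⟨p, hp⟩ := exists_encodesSeq fun n => 2 ^ (n + 1)
  exact ⟨p, _, hp, fun n => by simp⟩

theorem EncodesSeq.prefix_of_length_le {p : ℕ → Bool} {a : ℕ → ℤ} (h : EncodesSeq p a) {n m : ℕ}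
    (hn : (seqCode a n).length ≤ m) : seqCode a n <+: (List.range m).map p := by
  rw [h n, List.prefix_iff_eq_take, ← List.map_take, List.take_range]
  simp [hn]

/-- The dyadic point denoted by a word. -/
noncomputable def dyadicPoint (w : List Bool) : I :=
  ⟨(natVal w : ℝ) / 2 ^ w.length, by positivity, by
    rw [div_le_one (by positivity)]
    exact_mod_cast (natVal_lt w).le⟩

/-- The word for the value of `g` at the dyadic point of `w`, rounded down. -/
noncomputable def roundName (g : I → ℝ) (w : List Bool) : List Bool :=
  true :: wordOf (w.length + 2) ⌊g (dyadicPoint w) * 2 ^ (w.length + 1)⌋₊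

theorem length_roundName (g : I → ℝ) (w : List Bool) : (roundName g w).length = w.length + 3 := by
  simp [roundName, length_wordOf]

theorem isDyadicFunName_roundName {g : I → ℝ} (hg : ∀ x, g x ∈ Icc (0 : ℝ) 1) :
    IsDyadicFunName (roundName g) g := by
  refine ⟨fun v w h => by simpa [length_roundName] using h, fun w => ⟨dyadicPoint w, ?_, ?_⟩⟩
  · simp [dyadicPoint]
  · obtain ⟨h0, h1⟩ := hg (dyadicPoint w)
    set m := w.length
    set y := g (dyadicPoint w)
    have hm : (0 : ℝ) < 2 ^ (m + 1) := by positivity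
    -- The value `y = 1` has numerator `2 ^ (m + 1)`, which is why `roundName` spends `m + 2`
    -- digits.
    have hlt : ⌊y * 2 ^ (m + 1)⌋₊ < 2 ^ (m + 2) := by
      rw [Nat.floor_lt (by positivity)]
      push_cast
      rw [pow_succ 2 (m + 1)]
      nlinarith
    have hv : intVal (roundName g w) = (⌊y * 2 ^ (m + 1)⌋₊ : ℤ) := by
      simp only [roundName, intVal]
      rw [natVal_wordOf hlt]
    rw [hv]
    push_cast
    have h2 := Nat.floor_le (a := y * 2 ^ (m + 1)) (by positivity)
    have h3 := Nat.lt_floor_add_one (y * 2 ^ (m + 1))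
    have e : (2 ^ m : ℝ)⁻¹ = 2 / 2 ^ (m + 1) := by rw [pow_succ]; field_simp
    rw [e, abs_le]
    constructor
    · rw [neg_le_sub_iff_le_add, ← add_div, le_div_iff₀ hm]
      linarith
    · rw [sub_le_iff_le_add, div_add' _ _ _ hm.ne', div_le_div_iff_of_pos_right hm]
      linarith

/-- Rounding down hides every value below the resolution of the query: the answer is the one for the
zero function. -/
theorem roundName_eq_of_lt {g : I → ℝ} {w : List Bool}
    (h : g (dyadicPoint w) < (2 ^ (w.length + 1) : ℝ)⁻¹) :
    roundName 0 w = roundName g w := by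
  have : ⌊g (dyadicPoint w) * 2 ^ (w.length + 1)⌋₊ = 0 := by
    rw [Nat.floor_eq_zero, ← lt_inv_mul_iff₀' (by positivity)]
    simpa using h
  simp [roundName, this]

/-- The Lipschitz name, with Lipschitz constant `1`, that belongs to `roundName`. -/
noncomputable def roundLipName (g : I → ℝ) (w : List Bool) : List Bool :=
  pairWord (bin ((1 : ℕ) : ℤ)) (roundName g w)

/-- Independence of `g` matters: the same bound `T n (fun m => m + 6)` applies to zero and to all
bumps. The code of the constant `1` takes three bits, and the value three more than `w`. -/
theorem length_roundLipName (g : I → ℝ) (w : List Bool) :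
    (roundLipName g w).length = w.length + 6 := by
  have : bin (1 : ℤ) = [true] := by simp [bin]
  simp [roundLipName, pairWord, selfDelim_length, length_roundName, this]
  omega

theorem isLipName_roundLipName {g : I → ℝ} (hg : g ∈ LipOneUnit) : IsLipName (roundLipName g) g :=
  ⟨1, roundName g, by simpa using hg.1, isDyadicFunName_roundName hg.2, fun _ => rfl⟩

theorem strLen_roundLipName (g : I → ℝ) : strLen (roundLipName g) = fun m => m + 6 := by
  funext m
  simp [strLen, length_roundLipName]

/-! ## Narrow analytic bumps -/

/-- A narrow Gaussian bump around `c`. -/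
noncomputable def bump (N c : ℝ) (x : I) : ℝ := (2 * N)⁻¹ * Real.exp (-(N * ((x : ℝ) - c) ^ 2))

theorem bump_nonneg {N : ℝ} (hN : 0 < N) (c : ℝ) (x : I) : 0 ≤ bump N c x := by
  unfold bump; positivity

/-- The factor `(2 * N)⁻¹` cancels the `2 * N` from differentiating the exponent. What remains is `x
- c` times an exponential, both at most `1` in absolute value. -/
theorem lipschitzWith_bump {N c : ℝ} (hN : 0 < N) (hc : c ∈ Icc (0 : ℝ) 1) :
    LipschitzWith 1 (bump N c) := by
  have hd : ∀ x : ℝ, HasDerivAt (fun x : ℝ => (2 * N)⁻¹ * Real.exp (-(N * (x - c) ^ 2)))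
      (-((x - c) * Real.exp (-(N * (x - c) ^ 2)))) x := fun x => by
    have h1 : HasDerivAt (fun x : ℝ => -(N * (x - c) ^ 2)) (-(N * (2 * (x - c)))) x := by
      have := (((hasDerivAt_id x).sub_const c).pow 2).const_mul N
      simpa using HasDerivAt.fun_neg this
    convert! (h1.exp.const_mul (2 * N)⁻¹) using 1
    field_simp
  have hL : LipschitzOnWith 1 (fun x : ℝ => (2 * N)⁻¹ * Real.exp (-(N * (x - c) ^ 2)))
      (Icc (0 : ℝ) 1) := by
    refine (convex_Icc 0 1).lipschitzOnWith_of_nnnorm_hasDerivWithin_le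
      (fun x _ => (hd x).hasDerivWithinAt) fun x hx => ?_
    rw [← NNReal.coe_le_coe, coe_nnnorm, norm_neg, norm_mul, Real.norm_eq_abs, Real.norm_eq_abs,
      Real.abs_exp]
    have h1 : |x - c| ≤ 1 := abs_le.2 ⟨by linarith [hx.1, hc.2], by linarith [hx.2, hc.1]⟩
    have h2 : Real.exp (-(N * (x - c) ^ 2)) ≤ 1 :=
      Real.exp_le_one_iff.2 (neg_nonpos.2 (by positivity))
    exact mul_le_one₀ h1 (Real.exp_nonneg _) h2
  intro x y
  exact hL x.2 y.2

theorem bump_le {N : ℝ} (hN : 0 < N) (c : ℝ) (x : I) : bump N c x ≤ (2 * N)⁻¹ :=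
  mul_le_of_le_one_right (by positivity)
    (Real.exp_le_one_iff.2 (neg_nonpos.2 (by positivity)))

theorem bump_mem_lipOneUnit {N c : ℝ} (hN : 1 ≤ N) (hc : c ∈ Icc (0 : ℝ) 1) :
    bump N c ∈ LipOneUnit := by
  have hN0 : 0 < N := by linarith
  exact ⟨lipschitzWith_bump hN0 hc, fun x => ⟨bump_nonneg hN0 c x,
    (bump_le hN0 c x).trans (inv_le_one_of_one_le₀ (by linarith))⟩⟩

theorem bump_mem_holomorphicOn (N c : ℝ) (A : Set ℂ) : bump N c ∈ HolomorphicOn A := by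
  refine ⟨univ, fun z => (2 * N : ℂ)⁻¹ * Complex.exp (-(N * (z - c) ^ 2)), isOpen_univ,
    subset_univ _, ?_, fun x => ?_⟩
  · exact Differentiable.differentiableOn (by fun_prop)
  · simp [bump]

theorem zero_mem_lipOneUnit : (0 : I → ℝ) ∈ LipOneUnit :=
  ⟨(LipschitzWith.const 0).weaken zero_le_one, fun x => by simp⟩

theorem zero_mem_holomorphicOn (A : Set ℂ) : (0 : I → ℝ) ∈ HolomorphicOn A :=
  ⟨univ, 0, isOpen_univ, subset_univ _, differentiableOn_const 0, fun x => by simp⟩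

theorem parMax_zero (u v : I) : parMax 0 u v = 0 := by
  obtain ⟨x, -, hx⟩ := (isGreatest_parMax (f := 0) continuous_const u v).1
  exact hx.symm

theorem parInt_zero (u v : I) : parInt 0 u v = 0 := by
  simp [parInt, IccExtend]

/-- The peak value `(2 * N)⁻¹` would do; the weaker bound is the one shared with the integral. -/
theorem le_parMax_bump {N : ℝ} (hN : 1 ≤ N) (c : I) :
    (8 * N ^ 2)⁻¹ ≤ parMax (bump N c) 0 1 := by
  have hc : Continuous (bump N c) := by unfold bump; fun_prop
  have h1 : bump N c c ≤ parMax (bump N c) 0 1 :=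
    (isGreatest_parMax hc 0 1).2 ⟨c, ⟨by simp, by simpa using unitInterval.le_one'⟩, rfl⟩
  refine le_trans ?_ h1
  simp only [bump, sub_self, ne_eq, OfNat.ofNat_ne_zero, not_false_eq_true, zero_pow, mul_zero,
    neg_zero, Real.exp_zero, mul_one]
  have : N ≤ N ^ 2 := le_self_pow₀ hN (by norm_num)
  gcongr
  linarith

/-- On `[c, c + N⁻¹]` the exponent is at least `-1`, so the bump is at least `(2 * N)⁻¹ / e ≥ (8 *
N)⁻¹` on a length of `N⁻¹`. -/
theorem le_parInt_bump {N : ℝ} (hN : 1 ≤ N) (c : I) (hc : (c : ℝ) + N⁻¹ ≤ 1) :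
    (8 * N ^ 2)⁻¹ ≤ parInt (bump N c) 0 1 := by
  have hN0 : 0 < N := by linarith
  have hcont : Continuous (IccExtend zero_le_one (bump N c)) := by
    refine Continuous.Icc_extend' ?_
    unfold bump; fun_prop
  have hci : (c : ℝ) ≤ c + N⁻¹ := by simp [hN0.le]
  have hsplit : ∫ x in (c : ℝ)..(c + N⁻¹), IccExtend zero_le_one (bump N c) x ≤
      parInt (bump N c) 0 1 := by
    unfold parInt
    simp only [Icc.coe_zero, Icc.coe_one, zero_le_one, inf_of_le_left, sup_of_le_right]
    refine intervalIntegral.integral_mono_interval c.2.1 hci hc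
      (ae_of_all _ fun x => ?_) (hcont.intervalIntegrable _ _)
    exact bump_nonneg hN0 _ _
  refine le_trans ?_ hsplit
  have hconst : ∫ _ in (c : ℝ)..(c + N⁻¹), (8 * N)⁻¹ ≤
      ∫ x in (c : ℝ)..(c + N⁻¹), IccExtend zero_le_one (bump N c) x := by
    refine intervalIntegral.integral_mono_on hci (by simp) (hcont.intervalIntegrable _ _) ?_
    intro x hx
    have hx01 : x ∈ Icc (0 : ℝ) 1 := ⟨c.2.1.trans hx.1, hx.2.trans hc⟩
    rw [IccExtend_of_mem _ _ hx01]
    have h1 : N * (x - c) ^ 2 ≤ 1 := by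
      have h2 : x - c ≤ N⁻¹ := by linarith [hx.2]
      have h3 : 0 ≤ x - c := by linarith [hx.1]
      have h4 : N * (x - c) ≤ 1 := by
        calc N * (x - c) ≤ N * N⁻¹ := by gcongr
          _ = 1 := mul_inv_cancel₀ hN0.ne'
      have h5 : x - c ≤ 1 := by linarith [hx01.2, c.2.1]
      nlinarith
    have h6 : (4 : ℝ)⁻¹ ≤ Real.exp (-1) := by
      rw [Real.exp_neg]
      gcongr
      linarith [Real.exp_one_lt_d9]
    have h7 : Real.exp (-1) ≤ Real.exp (-(N * (x - c) ^ 2)) := Real.exp_le_exp.2 (by linarith)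
    calc (8 * N)⁻¹ = (2 * N)⁻¹ * 4⁻¹ := by rw [← mul_inv]; ring_nf
      _ ≤ bump N c ⟨x, hx01⟩ := by unfold bump; gcongr; exact h6.trans h7
  refine le_trans (le_of_eq ?_) hconst
  rw [intervalIntegral.integral_const]
  simp only [add_sub_cancel_left, smul_eq_mul]
  field_simp

/-! ## The adversary argument -/

/-- Among `T + 1` equidistant points, one is far from `T` given points. -/
theorem exists_far_point {T : ℕ} (a : ℕ → ℝ) :
    ∃ i ≤ T, ∀ t < T, (2 * (T + 1 : ℝ))⁻¹ ≤ |a t - i / (T + 1)| := by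
  -- Pigeonhole: otherwise two of the `T + 1` grid points are both near the same `a t`, hence closer
  -- to each other than the spacing `1 / (T + 1)`.
  by_contra! h
  choose! s hs hs' using h
  obtain ⟨i, hi, j, hj, hij, he⟩ := Finset.exists_ne_map_eq_of_card_lt_of_maps_to
    (s := Finset.range (T + 1)) (t := Finset.range T) (by simp) (f := s)
    (fun i hi => by simpa using hs i (by simpa [Nat.lt_succ_iff] using hi))
  have h1 := hs' i (by simpa [Nat.lt_succ_iff] using hi)
  have h2 := hs' j (by simpa [Nat.lt_succ_iff] using hj)
  rw [he] at h1
  have hT : (0 : ℝ) < T + 1 := by positivity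
  have h3 : |(i : ℝ) / (T + 1) - j / (T + 1)| < (T + 1 : ℝ)⁻¹ := by
    calc |(i : ℝ) / (T + 1) - j / (T + 1)|
        = |(a (s j) - j / (T + 1)) - (a (s j) - i / (T + 1))| := by congr 1; ring
      _ ≤ |a (s j) - j / (T + 1)| + |a (s j) - i / (T + 1)| := abs_sub _ _
      _ < (2 * (T + 1 : ℝ))⁻¹ + (2 * (T + 1 : ℝ))⁻¹ := add_lt_add h2 h1
      _ = (T + 1 : ℝ)⁻¹ := by field_simp; norm_num
  rw [← sub_div, abs_div, abs_of_pos hT, div_lt_iff₀ hT, inv_mul_cancel₀ hT.ne'] at h3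
  have h4 : |(i : ℤ) - j| < 1 := by exact_mod_cast h3
  rw [Int.abs_lt_one_iff] at h4
  omega

/-- At distance `1/(2(T+1))` the exponent reaches `24(T+1)³ / (4(T+1)²) = 6(T+1)`, more than the
word length. As `e > 2`, the exponential is at most `2⁻ᵐ` for a word of length `m`. -/
theorem bump_lt_of_far {N c : ℝ} {T : ℕ} (hN : 24 * (T + 1 : ℝ) ^ 3 ≤ N) {w : List Bool}
    (hw : w.length ≤ 6 * T) (hc : (2 * (T + 1 : ℝ))⁻¹ ≤ |(dyadicPoint w : ℝ) - c|) :
    bump N c (dyadicPoint w) < (2 ^ (w.length + 1) : ℝ)⁻¹ := by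
  have hT : (0 : ℝ) ≤ T := by positivity
  have hT1 : (1 : ℝ) ≤ (T + 1 : ℝ) ^ 3 := one_le_pow₀ (by linarith)
  have hN0 : 0 < N := by linarith
  have h1 : 6 * (T : ℝ) ≤ N * ((dyadicPoint w : ℝ) - c) ^ 2 := by
    rw [← sq_abs]
    calc 6 * (T : ℝ) ≤ 6 * (T + 1) := by linarith
      _ = 24 * (T + 1 : ℝ) ^ 3 * ((2 * (T + 1 : ℝ))⁻¹) ^ 2 := by field_simp; norm_num
      _ ≤ _ := by gcongr
  have h2 : Real.exp (-(N * ((dyadicPoint w : ℝ) - c) ^ 2)) ≤ (2 ^ w.length : ℝ)⁻¹ := by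
    rw [Real.exp_neg]
    gcongr
    calc (2 : ℝ) ^ w.length ≤ 2 ^ (6 * T) := pow_le_pow_right₀ one_le_two hw
      _ ≤ Real.exp 1 ^ (6 * T) := by gcongr; linarith [Real.exp_one_gt_d9]
      _ = Real.exp (6 * T) := by rw [← Real.exp_nat_mul]; simp
      _ ≤ _ := Real.exp_le_exp.2 h1
  unfold bump
  calc _ ≤ (2 * N)⁻¹ * (2 ^ w.length : ℝ)⁻¹ := by gcongr
    _ < 2⁻¹ * (2 ^ w.length : ℝ)⁻¹ := by gcongr; linarith
    _ = _ := by rw [pow_succ, mul_inv]; ring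

/-- Take `ε = 1/16` along multiples of `16`. This leaves room for `N = 2 ^ (4 * i)`: it exceeds
`24(2 ^ i + 1)³`, while `2 ^ (16 * i) = N ^ 4` dwarfs `8 * N ^ 2`. -/
theorem Subexponential.exists_le {T : ℕ → (ℕ → ℕ) → ℕ} (hT : Subexponential T) (k : ℕ) :
    ∃ i, 8 ≤ i ∧ T (16 * i) (fun m => m + k) ≤ 2 ^ i := by
  have h := hT k 16⁻¹ (by norm_num)
  have h2 : Tendsto (fun i : ℕ => 16 * i) atTop atTop :=
    tendsto_id.const_mul_atTop' (by norm_num)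
  obtain ⟨i, hi, h8⟩ := ((h2.eventually h).and (eventually_ge_atTop 8)).exists
  refine ⟨i, h8, ?_⟩
  have e : (16⁻¹ : ℝ) * ((16 * i : ℕ) : ℝ) = (i : ℝ) := by push_cast; ring
  rw [e, Real.rpow_natCast] at hi
  exact_mod_cast hi

/-- An operator that responds to narrow bumps cannot be computed in subexponential time. -/
theorem not_computableOperatorInTime {F : Set (I → ℝ)} (hF : F ⊆ LipOneUnit)
    {op : (I → ℝ) → I → I → ℝ} (h0 : (0 : I → ℝ) ∈ F) (hop0 : op 0 0 1 = 0)
    (hb : ∀ (N : ℝ) (c : I), 1 ≤ N → (c : ℝ) + N⁻¹ ≤ 1 →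
      bump N c ∈ F ∧ (8 * N ^ 2)⁻¹ ≤ op (bump N c) 0 1)
    {T : ℕ → (ℕ → ℕ) → ℕ} (hT : Subexponential T) : ¬ ComputableOperatorInTime F op T := by
  rintro ⟨M, hM⟩
  obtain ⟨p, hp⟩ := exists_isRealName_zero
  obtain ⟨q, hq⟩ := exists_isRealName_one
  obtain ⟨i, hi8, hi⟩ := hT.exists_le 6
  set n := 16 * i with hn
  set S := T n (fun m => m + 6) with hS
  set inp := fun j => some (interleave p q j)
  -- After `S` steps the output already contains the code of the `n`-th numerator. Functions with
  -- the same configuration at that time share this numerator `b`.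
  have key : ∀ g ∈ F, ∃ b : ℤ, |op g 0 1 - (b : ℝ) / 2 ^ (n + 1)| ≤ (2 ^ n : ℝ)⁻¹ ∧
      ∀ g' ∈ F, M.run (roundLipName g') inp S = M.run (roundLipName g) inp S →
        |op g' 0 1 - (b : ℝ) / 2 ^ (n + 1)| ≤ (2 ^ n : ℝ)⁻¹ := by
    have hrun : ∀ g ∈ F, ∃ a : ℕ → ℤ, DyadicApprox a (op g 0 1) ∧
        seqCode a (n + 1) <+: (M.run (roundLipName g) inp S).output := by
      intro g hg
      obtain ⟨τ, a, h1, h2, h3, h4⟩ := hM g hg 0 1 (roundLipName g) p q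
        (isLipName_roundLipName (hF hg)) hp hq
      refine ⟨a, h3, ?_⟩
      have h5 := h4 n
      rw [strLen_roundLipName] at h5
      rw [h1.1]
      exact h2.prefix_of_length_le h5
    intro g hg
    obtain ⟨a, ha, ha'⟩ := hrun g hg
    refine ⟨a n, ha n, fun g' hg' he => ?_⟩
    obtain ⟨a', hb, hb'⟩ := hrun g' hg'
    rw [he] at hb'
    rw [eq_of_seqCode_prefix ha' hb']
    exact hb n
  obtain ⟨b, hb1, hb2⟩ := key 0 h0
  -- The points to avoid are those denoted by the query tape at each of the times `t < S` in the run
  -- on the zero function.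
  obtain ⟨j, hj, hfar⟩ := exists_far_point (T := S)
    fun t => (dyadicPoint (M.run (roundLipName 0) inp t).query : ℝ)
  set N : ℝ := 2 ^ (4 * i) with hNdef
  have hSi : (S : ℝ) ≤ 2 ^ i := by exact_mod_cast hi
  have hi1 : (256 : ℝ) ≤ 2 ^ i := by
    calc (256 : ℝ) = 2 ^ 8 := by norm_num
      _ ≤ 2 ^ i := pow_le_pow_right₀ one_le_two hi8
  have hNi : N = (2 ^ i) ^ 4 := by rw [hNdef, ← pow_mul, mul_comm]
  have hNS : 24 * (S + 1 : ℝ) ^ 3 ≤ N := by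
    calc 24 * (S + 1 : ℝ) ^ 3 ≤ 24 * (2 * 2 ^ i) ^ 3 := by gcongr; linarith
      _ = 192 * (2 ^ i) ^ 3 := by ring
      _ ≤ 2 ^ i * (2 ^ i) ^ 3 := by gcongr; linarith
      _ = N := by rw [hNi]; ring
  have hS1 : (1 : ℝ) ≤ S + 1 := by have : (0 : ℝ) ≤ S := by positivity
                                   linarith
  have hNS1 : (S + 1 : ℝ) ≤ N := by
    have : (S + 1 : ℝ) ≤ (S + 1 : ℝ) ^ 3 := le_self_pow₀ hS1 (by norm_num)
    linarith
  have hjS : (j : ℝ) ≤ S := by exact_mod_cast hj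
  have hS0 : (0 : ℝ) < S + 1 := by linarith
  let c : I := ⟨(j : ℝ) / (S + 1), by positivity, by rw [div_le_one hS0]; linarith⟩
  have hcN : (c : ℝ) + N⁻¹ ≤ 1 := by
    calc (c : ℝ) + N⁻¹ ≤ S / (S + 1) + (S + 1 : ℝ)⁻¹ := by
          gcongr
          show (j : ℝ) / (S + 1) ≤ _
          gcongr
      _ = 1 := by field_simp
  obtain ⟨hcF, hcop⟩ := hb N c (by linarith) hcN
  have hsame : M.run (roundLipName (bump N c)) inp S = M.run (roundLipName 0) inp S := by
    refine M.run_congr inp (T := S) (fun t ht => ?_) le_rfl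
    have hlen := M.length_query_run_le inp (ψ := roundLipName 0) (k := 6) (by norm_num)
      (fun w => (length_roundLipName 0 w).le) t
    exact congrArg (pairWord _)
      (roundName_eq_of_lt (bump_lt_of_far hNS (by omega) (hfar t ht)))
  have hb3 := hb2 _ hcF hsame
  rw [hop0] at hb1
  have h1 : op (bump N c) 0 1 ≤ 2 * (2 ^ n : ℝ)⁻¹ := by
    have := abs_le.1 hb1
    have := abs_le.1 hb3
    linarith
  have h2 : (8 * N ^ 2)⁻¹ ≤ 2 * (2 ^ n : ℝ)⁻¹ := hcop.trans h1
  have h3 : (2 : ℝ) ^ n = N ^ 4 := by rw [hNdef, ← pow_mul]; congr 1; omega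
  have hN1 : (256 : ℝ) ≤ N := by
    rw [hNi]; exact hi1.trans (le_self_pow₀ (by linarith) (by norm_num))
  -- Now `1/(8N²) ≤ 2/N⁴` would force `N² ≤ 16`, against `N ≥ 256`.
  rw [h3, inv_le_iff_one_le_mul₀ (by positivity), mul_comm, ← mul_assoc,
    ← div_eq_mul_inv, one_le_div (by positivity)] at h2
  have h4 : N ^ 2 * 256 ≤ N ^ 2 * N ^ 2 := by
    gcongr
    exact hN1.trans (le_self_pow₀ (by linarith) (by norm_num))
  nlinarith [pow_pos (by linarith : (0 : ℝ) < N) 2]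

/-! ## Lipschitz constants cannot be computed from a modulus of continuity -/

/-- A ramp of slope `K` and height `h`. -/
noncomputable def ramp (K h : ℝ) (x : I) : ℝ := min h (K * x)

theorem abs_ramp_sub_le {K h : ℝ} (hK : 0 ≤ K) (x y : I) :
    |ramp K h x - ramp K h y| ≤ K * |(x : ℝ) - y| := by
  unfold ramp
  refine (abs_min_sub_min_le_max _ _ _ _).trans ?_
  rw [sub_self, abs_zero, ← mul_sub, abs_mul, abs_of_nonneg hK]
  exact max_le (by positivity) le_rfl

theorem ramp_mem_Icc {K h : ℝ} (hK : 0 ≤ K) (hh : 0 ≤ h) (x : I) : ramp K h x ∈ Icc 0 h :=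
  ⟨le_min hh (mul_nonneg hK x.2.1), min_le_left _ _⟩

/-- The increment is bounded by `h` and by `K * |x - y|`, so its square is at most `h * K * |x - y|
≤ |x - y|`. Thus one modulus serves arbitrarily steep ramps. -/
theorem isModulus_ramp {K h : ℝ} (hK : 0 ≤ K) (hh : 0 ≤ h) (hhK : h * K ≤ 1) :
    IsModulus (fun n => 2 * n) (ramp K h) := by
  intro n x y hxy
  have h1 := abs_ramp_sub_le (h := h) hK x y
  have h2 : |ramp K h x - ramp K h y| ≤ h := by
    have hx := ramp_mem_Icc hK hh x
    have hy := ramp_mem_Icc hK hh y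
    exact abs_le.2 ⟨by linarith [hx.1, hy.2], by linarith [hx.2, hy.1]⟩
  refine abs_le_of_sq_le_sq ?_ (by positivity)
  calc (ramp K h x - ramp K h y) ^ 2 = |ramp K h x - ramp K h y| * |ramp K h x - ramp K h y| := by
        rw [← sq, sq_abs]
    _ ≤ h * (K * (2 ^ (2 * n))⁻¹) := by gcongr; exact h1.trans (by gcongr)
    _ = h * K * (2 ^ (2 * n))⁻¹ := by ring
    _ ≤ 1 * (2 ^ (2 * n))⁻¹ := by gcongr
    _ = ((2 ^ n)⁻¹) ^ 2 := by rw [one_mul, inv_pow, ← pow_mul, mul_comm]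

/-- Compare the corner `h / K` with `0`; `h ≤ K` keeps the corner in the unit interval. -/
theorem lt_of_lipschitzWith_ramp {K h : ℝ} {l : ℝ≥0} (hK : 0 < K) (hh : 0 < h) (hhK : h ≤ K)
    (hl : LipschitzWith l (ramp K h)) : K ≤ l := by
  have := hl.dist_le_mul ⟨h / K, by positivity, (div_le_one hK).2 hhK⟩ 0
  simp only [Subtype.dist_eq, Real.dist_eq, ramp, Icc.coe_zero, mul_zero, sub_zero] at this
  rw [mul_div_cancel₀ _ hK.ne', min_self, min_eq_right hh.le, sub_zero, abs_of_pos hh,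
    abs_of_pos (by positivity), mul_div_assoc', le_div_iff₀ hK] at this
  nlinarith

/-- The modulus name, with modulus `2n`, that belongs to `roundName`. -/
noncomputable def roundModulusName (g : I → ℝ) (w : List Bool) : List Bool :=
  List.replicate (2 * w.length) true ++ false :: roundName g w

theorem isModulusName_roundModulusName {g : I → ℝ} (hg : ∀ x, g x ∈ Icc (0 : ℝ) 1)
    (hm : IsModulus (fun n => 2 * n) g) : IsModulusName (roundModulusName g) g := by
  refine ⟨fun v w h => ?_, fun n => 2 * n, roundName g, hm, isDyadicFunName_roundName hg,
    fun _ => rfl⟩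
  simp only [roundModulusName, List.length_append, List.length_replicate, List.length_cons,
    length_roundName]
  omega

theorem not_reducesTo_isModulusName_isLipName : ¬ ReducesTo LipFun IsModulusName IsLipName := by
  rintro ⟨M, hM⟩
  have hmod0 : IsModulus (fun n => 2 * n) (0 : I → ℝ) := fun n x y _ => by simp
  obtain ⟨φ₀, ⟨l, ψ₀, -, -, h₀⟩, hout₀⟩ := hM 0 ⟨0, LipschitzWith.const 0⟩ _
    (isModulusName_roundModulusName (fun x => by simp) hmod0)
  -- One input word suffices, since the Lipschitz constant heads the answer to every word.
  obtain ⟨t, ht, ht'⟩ := hout₀ []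
  set inp : ℕ → Option Bool := fun i => ([] : List Bool)[i]?
  obtain ⟨L, hL⟩ : ∃ L, ∀ s < t, (M.run (roundModulusName 0) inp s).query.length ≤ L :=
    ⟨(Finset.range t).sup fun s => (M.run (roundModulusName 0) inp s).query.length,
      fun s hs => Finset.le_sup (f := fun s => (M.run (roundModulusName 0) inp s).query.length)
        (Finset.mem_range.2 hs)⟩
  set K : ℝ := l + 1 with hKdef
  have hK : 1 ≤ K := by simp [hKdef]
  -- The first factor puts the ramp below the resolution of all queries of length at most `L`; the
  -- second gives `h * K ≤ 1`, so the modulus is the one announced for the zero function.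
  set h : ℝ := (2 ^ (L + 2) : ℝ)⁻¹ * K⁻¹ with hh
  have hK' : K⁻¹ ≤ 1 := inv_le_one_of_one_le₀ hK
  have h2 : (2 ^ (L + 2) : ℝ)⁻¹ ≤ 1 := inv_le_one_of_one_le₀ (one_le_pow₀ one_le_two)
  have hpos : 0 < h := by positivity
  have hle : h ≤ (2 ^ (L + 2) : ℝ)⁻¹ := mul_le_of_le_one_right (by positivity) hK'
  have hhK : h * K ≤ 1 := by
    rw [hh, mul_assoc, inv_mul_cancel₀ (by positivity), mul_one]; exact h2
  have hrange : ∀ x, ramp K h x ∈ Icc (0 : ℝ) 1 := fun x =>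
    ⟨(ramp_mem_Icc (by positivity) hpos.le x).1,
      (ramp_mem_Icc (by positivity) hpos.le x).2.trans (hle.trans h2)⟩
  have hlip : ramp K h ∈ LipFun := ⟨⟨K, by positivity⟩, LipschitzWith.of_dist_le_mul fun x y =>
    abs_ramp_sub_le (by positivity) x y⟩
  obtain ⟨φ₁, ⟨l₁, ψ₁, hl₁, -, h₁⟩, hout₁⟩ := hM _ hlip _
    (isModulusName_roundModulusName hrange (isModulus_ramp (by positivity) hpos.le hhK))
  have hsame : M.run (roundModulusName (ramp K h)) inp t = M.run (roundModulusName 0) inp t := by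
    refine M.run_congr inp (T := t) (fun s hs => ?_) le_rfl
    refine congrArg (fun v => List.replicate _ true ++ false :: v) (roundName_eq_of_lt ?_)
    refine ((ramp_mem_Icc (by positivity) hpos.le _).2.trans hle).trans_lt ?_
    gcongr
    · norm_num
    · have := hL s hs
      omega
  have hout : M.Outputs (roundModulusName (ramp K h)) [] (φ₀ []) :=
    ⟨t, by rw [← ht]; exact congrArg _ hsame, by rw [← ht']; exact congrArg _ hsame⟩
  have he := hout.unique (hout₁ [])
  rw [h₀, h₁] at he
  have he' := congrArg (fun w => (scan w).head?) he
  simp only [head?_scan_pairWord, Option.some.injEq] at he'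
  have hll : l = l₁ := by exact_mod_cast bin_injective he'
  have := lt_of_lipschitzWith_ramp (by positivity) hpos (by linarith) hl₁
  rw [← hll, hKdef] at this
  simp at this
  linarith

/-! ## Programs: oracle machines with a primitive recursive control -/

section Program

variable {X : Type} [Primcodable X]

/-- A tape access of a program, coded by three bits: read from the input, clear or pop the query,
ask the oracle, push a bit to the query, write a bit. -/
abbrev TapeOp := Bool × Bool × Bool

namespace TapeOp
/-- Read the next input bit. -/
abbrev read : TapeOp := (false, false, false)
/-- Erase the query tape. -/
abbrev clear : TapeOp := (false, false, true)
/-- Read and remove the first bit of the query tape. -/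
abbrev pop : TapeOp := (false, true, false)
/-- Call the oracle. -/
abbrev ask : TapeOp := (false, true, true)
/-- Write a bit in front of the query tape. -/
abbrev push (b : Bool) : TapeOp := (true, false, b)
/-- Write a bit on the output tape. -/
abbrev write (b : Bool) : TapeOp := (true, true, b)
end TapeOp

/-- The tapes a program has access to: input position, query tape and output tape. -/
structure Tapes where
  pos : ℕ
  query : List Bool
  output : List Bool

/-- The effect of a tape access: the bit that was read (if any) and the new tapes. -/
def Tapes.exec (ψ : List Bool → List Bool) (inp : ℕ → Option Bool) (d : Tapes) :
    TapeOp → Option Bool × Tapes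
  | (false, false, false) => (inp d.pos, { d with pos := d.pos + 1 })
  | (false, false, true) => (none, { d with query := [] })
  | (false, true, false) => (d.query.head?, { d with query := d.query.tail })
  | (false, true, true) => (none, { d with query := ψ d.query })
  | (true, false, b) => (none, { d with query := b :: d.query })
  | (true, true, b) => (none, { d with output := d.output ++ [b] })

/-- One step of the program with control function `next`, which maps the last bit read and the state
to the next tape access and the next state. -/
def progStep (next : Option Bool → X → TapeOp × X) (ψ : List Bool → List Bool)
    (inp : ℕ → Option Bool) (x : Option Bool × X × Tapes) : Option Bool × X × Tapes :=
  let y := next x.1 x.2.1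
  let e := x.2.2.exec ψ inp y.1
  (e.1, y.2, e.2)

end Program

/-! ### Running a compiled partial recursive code in a loop as an oracle machine. -/

namespace Turing.PartrecToTM2

open Turing.ToPartrec

instance : Fintype K' :=
  ⟨{K'.main, K'.rev, K'.aux, K'.stack}, fun x => by cases x <;> simp⟩

/-- The labels of an oracle machine that runs the code `c` in a loop: those of the code, one for each
tape access, and three more (initialization, decoding of the tape access, storing the answer). -/
abbrev LoopLabel (c : Code) : Type :=
  {l // l ∈ codeSupp c Cont'.halt} ⊕ TapeOp ⊕ Fin 3

abbrev LoopStmt (c : Code) : Type := TM2.Stmt (fun _ : K' => Γ') (LoopLabel c) (Option Γ')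

variable (c : Code)

abbrev LoopLabel.decode : LoopLabel c := Sum.inr (Sum.inr 1)

/-- The label for continuing at a position of the code, where halting means to go on with decoding
the result. -/
def loopLabel : Option Λ' → LoopLabel c
  | none => LoopLabel.decode c
  -- Restricting to `codeSupp` makes the label type finite. The fallback is never reached from a
  -- supported label, by `tr_supports`.
  | some l => if h : l ∈ codeSupp c Cont'.halt then Sum.inl ⟨l, h⟩ else LoopLabel.decode c

open TM2.Stmt in
/-- Translation of the statements of the code. -/
def loopStmt : TM2.Stmt (fun _ : K' => Γ') Λ' (Option Γ') → LoopStmt c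
  | push k f q => push k f (loopStmt q)
  | peek k f q => peek k f (loopStmt q)
  | pop k f q => pop k f (loopStmt q)
  | load f q => load f (loopStmt q)
  | branch f q r => branch f (loopStmt q) (loopStmt r)
  | goto l => goto fun v => loopLabel c (some (l v))
  | .halt => goto fun _ => LoopLabel.decode c

theorem stepAux_loopStmt (q : TM2.Stmt (fun _ : K' => Γ') Λ' (Option Γ')) (v : Option Γ')
    (S : K' → List Γ') :
    TM2.stepAux (loopStmt c q) v S =
      ⟨some (loopLabel c (TM2.stepAux q v S).l), (TM2.stepAux q v S).var,
        (TM2.stepAux q v S).stk⟩ := by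
  induction q generalizing v S with
  | branch f q r ihq ihr =>
    simp only [loopStmt, TM2.stepAux]
    cases f v
    · exact ihr _ _
    · exact ihq _ _
  | goto l => rfl
  | halt => rfl
  | load _ q ih => exact ih _ _
  | _ _ _ q ih => exact ih _ _

open TM2.Stmt in
/-- Pop the code of a bit from the main stack and continue with it. -/
def popBit (k : Bool → LoopStmt c) : LoopStmt c :=
  pop K'.main (fun _ v => v) <|
    branch (fun v => decide (v = some Γ'.bit1)) (pop K'.main (fun _ v => v) (k true)) (k false)

theorem trNat_one : trNat 1 = [Γ'.bit1] := by
  rw [trNat, Nat.cast_one]; rfl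

theorem trNat_two : trNat 2 = [Γ'.bit0, Γ'.bit1] := by
  rw [trNat, show ((2 : ℕ) : Num) = Num.pos (PosNum.bit0 PosNum.one) from rfl]; rfl

/-- In `trList` the number `0` is the bare separator `cons` and `1` is `bit1` followed by `cons`.
The first symbol decides, and only `1` needs a second pop. -/
theorem stepAux_popBit (k : Bool → LoopStmt c) (b : Bool) (v : Option Γ') (L : List ℕ)
    (x y z : List Γ') :
    TM2.stepAux (popBit c k) v (K'.elim (trList (b.toNat :: L)) x y z) =
      TM2.stepAux (k b) (some Γ'.cons) (K'.elim (trList L) x y z) := by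
  cases b <;> simp [popBit, trNat_one]

/-- The bit represented by a symbol. -/
def symbolBit : Option Γ' → Option Bool
  | some Γ'.bit0 => some false
  | some Γ'.bit1 => some true
  | _ => none

/-- The symbol that represents a bit. -/
def bitSymbol : Option Bool → Option Γ'
  | none => none
  | some false => some Γ'.bit0
  | some true => some Γ'.bit1

open TM2.Stmt in
/-- Start the code. -/
def restart : LoopStmt c :=
  load (fun _ => none) <| goto fun _ => loopLabel c (some (trNormal c Cont'.halt))

open TM2.Stmt in
/-- Push the code of the bit that was read, if any, to the main stack, and start the code. -/
def storeStmt : LoopStmt c :=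
  push K'.main (fun _ => Γ'.cons) <|
    branch (fun v => (symbolBit v).isSome)
      (push K'.main (fun _ => Γ'.bit1) <| branch (fun v => decide (symbolBit v = some false))
        (restart c) (push K'.main (fun _ => Γ'.bit0) (restart c)))
      (restart c)

/-- No bit, `false` and `true` have the codes `0`, `1`, `2`. Numerals have their lowest bit on top,
so `bit1` is pushed before the optional `bit0`. -/
theorem stepAux_storeStmt (v : Option Γ') (L : List ℕ) (x y z : List Γ') :
    TM2.stepAux (storeStmt c) v (K'.elim (trList L) x y z) =
      ⟨some (loopLabel c (some (trNormal c Cont'.halt))), none,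
        K'.elim (trList (Encodable.encode (symbolBit v) :: L)) x y z⟩ := by
  simp only [storeStmt, restart, TM2.stepAux]
  rcases h : symbolBit v with _ | _ | _
  · simp
  · have : Encodable.encode (some false) = 1 := rfl
    simp [this, trNat_one]
  · have : Encodable.encode (some true) = 2 := rfl
    simp [this, trNat_two]

open TM2.Stmt in
/-- The program of the loop. -/
def loopProg : LoopLabel c → OracleInstr K' (fun _ => Γ') (LoopLabel c) (Option Γ')
  | Sum.inl l => .work (loopStmt c (tr l))
  | Sum.inr (Sum.inl a) =>
    match a with
    | (false, false, false) => .readInput (fun _ b => bitSymbol b) (Sum.inr (Sum.inr 2))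
    | (false, false, true) => .clearQuery (Sum.inr (Sum.inr 2))
    | (false, true, false) => .popQuery (fun _ b => bitSymbol b) (Sum.inr (Sum.inr 2))
    | (false, true, true) => .ask (Sum.inr (Sum.inr 2))
    | (true, false, b) => .pushQuery (fun _ => b) (Sum.inr (Sum.inr 2))
    | (true, true, b) => .writeOutput (fun _ => b) (Sum.inr (Sum.inr 2))
  -- Two separators code the list `[0, 0]`: no bit read, and the state with code `0`. This forces
  -- the initial state of a program to have code `0`.
  | Sum.inr (Sum.inr 0) =>
    .work <| push K'.main (fun _ => Γ'.cons) <| push K'.main (fun _ => Γ'.cons) (restart c)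
  | Sum.inr (Sum.inr 1) =>
    .work <| popBit c fun a => popBit c fun b => popBit c fun d =>
      goto fun _ => Sum.inr (Sum.inl (a, b, d))
  | Sum.inr (Sum.inr 2) =>
    .work (storeStmt c)

/-- The oracle machine that runs the code in a loop. -/
def loopMachine : OracleMachine where
  K := K'
  Γ := fun _ => Γ'
  Λ := LoopLabel c
  S := Option Γ'
  main := Sum.inr (Sum.inr 0)
  start := none
  prog := loopProg c

variable (ψ : List Bool → List Bool) (inp : ℕ → Option Bool)

/-- The configuration of the loop machine that corresponds to a configuration of the code. -/
def loopCfg (a : Cfg') (d : Tapes) : (loopMachine c).Cfg :=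
  ⟨some (loopLabel c (TM2.Cfg.l a)), TM2.Cfg.var a, TM2.Cfg.stk a, d.pos, d.query, d.output⟩

/-- Each step of the code is one step of the loop machine with the tapes untouched. Membership in
`codeSupp` is the invariant. -/
theorem loopMachine_reaches {a b : Cfg'} (d : Tapes)
    (h : StateTransition.Reaches (TM2.step tr) a b)
    (ha : TM2.Cfg.l a ∈ Finset.insertNone (codeSupp c Cont'.halt)) :
    ∃ t, ((loopMachine c).step ψ inp)^[t] (loopCfg c a d) = loopCfg c b d := by
  induction h using Relation.ReflTransGen.head_induction_on with
  | refl => exact ⟨0, rfl⟩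
  | @head a a' hab _ ih =>
    have ha' := @TM2.step_supports _ _ _ _ ⟨trNormal c Cont'.halt⟩ _ tr _
      (tr_supports c Cont'.halt) _ _ hab ha
    obtain ⟨t, ht⟩ := ih ha'
    refine ⟨t + 1, ?_⟩
    rw [Function.iterate_succ_apply]
    suffices hs : (loopMachine c).step ψ inp (loopCfg c a d) = loopCfg c a' d by rw [hs, ht]
    obtain ⟨l, v, S⟩ := a
    cases l with
    | none => cases Option.mem_def.1 hab
    | some l =>
      replace hab : TM2.stepAux (tr l) v S = a' := Option.some.inj (Option.mem_def.1 hab)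
      have hl : l ∈ codeSupp c Cont'.halt := Finset.some_mem_insertNone.1 ha
      subst hab
      have e : loopLabel c (some l) = Sum.inl ⟨l, hl⟩ := by simp [loopLabel, hl]
      have := stepAux_loopStmt c (tr l) v S
      simp only [loopCfg, OracleMachine.step, e, loopMachine, loopProg]
      erw [this]

/-- The configuration of the loop machine at the start of a round. -/
def roundCfg (r : Option Bool) (s : ℕ) (d : Tapes) : (loopMachine c).Cfg :=
  loopCfg c (init c [Encodable.encode r, s]) d

theorem init_reaches : ∃ t, ((loopMachine c).step ψ inp)^[t]
    (loopMachine c).initCfg = roundCfg c none 0 ⟨0, [], []⟩ := by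
  refine ⟨1, ?_⟩
  have e : (fun _ : K' => ([] : List Γ')) = K'.elim [] [] [] [] := by
    funext x; cases x <;> rfl
  simp only [Function.iterate_one, OracleMachine.initCfg, OracleMachine.step, loopMachine, loopProg,
    roundCfg, loopCfg, init, TM2.stepAux, restart]
  erw [e, K'.elim_update_main, K'.elim_update_main]
  simp

theorem store_step (v : Option Γ') (s : ℕ) (d : Tapes) :
    (loopMachine c).step ψ inp ⟨some (Sum.inr (Sum.inr 2)), v, K'.elim (trList [s]) [] [] [],
      d.pos, d.query, d.output⟩ = roundCfg c (symbolBit v) s d := by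
  simp only [OracleMachine.step, loopMachine, loopProg, roundCfg, loopCfg, init]
  erw [stepAux_storeStmt]

theorem symbolBit_bitSymbol (r : Option Bool) : symbolBit (bitSymbol r) = r := by
  rcases r with _ | _ | _ <;> rfl

/-- The bit read travels in the internal state. An access that reads nothing leaves the `cons` from
decoding there, and `symbolBit` treats it as no bit. -/
theorem tapeOp_step (a : TapeOp) (s : ℕ) (d : Tapes) :
    ∃ v, symbolBit v = (d.exec ψ inp a).1 ∧
    (loopMachine c).step ψ inp ⟨some (Sum.inr (Sum.inl a)), some Γ'.cons,
      K'.elim (trList [s]) [] [] [], d.pos, d.query, d.output⟩ =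
      ⟨some (Sum.inr (Sum.inr 2)), v, K'.elim (trList [s]) [] [] [],
      (d.exec ψ inp a).2.pos, (d.exec ψ inp a).2.query, (d.exec ψ inp a).2.output⟩ := by
  obtain ⟨x, y, z⟩ := a
  cases x <;> cases y <;> first
    | exact ⟨some Γ'.cons, rfl, rfl⟩
    | (cases z <;> first
      | exact ⟨some Γ'.cons, rfl, rfl⟩
      | exact ⟨_, symbolBit_bitSymbol _, rfl⟩)

theorem round_reaches {r : Option Bool} {s s' : ℕ} {a : TapeOp} (d : Tapes)
    (hc : c.eval [Encodable.encode r, s] = pure [a.1.toNat, a.2.1.toNat, a.2.2.toNat, s']) :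
    ∃ t, 0 < t ∧ ((loopMachine c).step ψ inp)^[t] (roundCfg c r s d) =
      roundCfg c (d.exec ψ inp a).1 s' (d.exec ψ inp a).2 := by
  have h1 : halt [a.1.toNat, a.2.1.toNat, a.2.2.toNat, s'] ∈
      StateTransition.eval (TM2.step tr) (init c [Encodable.encode r, s]) := by
    rw [tr_eval, hc]
    exact Part.mem_map_iff _ |>.2 ⟨_, Part.mem_some _, rfl⟩
  obtain ⟨t, ht⟩ := loopMachine_reaches c ψ inp d (StateTransition.mem_eval.1 h1).1
    (Finset.some_mem_insertNone.2 (codeSupp_self _ _ (trStmts₁_self _)))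
  obtain ⟨v, hv, hv'⟩ := tapeOp_step c ψ inp a s' d
  -- After the run of the code: decoding, the tape access, and storing the bit read.
  refine ⟨t + 1 + 1 + 1, by omega, ?_⟩
  rw [Function.iterate_succ_apply', Function.iterate_succ_apply', Function.iterate_succ_apply',
    roundCfg, ht]
  have h2 : (loopMachine c).step ψ inp
      (loopCfg c (halt [a.1.toNat, a.2.1.toNat, a.2.2.toNat, s']) d) =
      ⟨some (Sum.inr (Sum.inl a)), some Γ'.cons,
        K'.elim (trList [s']) [] [] [], d.pos, d.query, d.output⟩ := by
    simp only [OracleMachine.step, loopMachine, loopCfg, halt, loopLabel, loopProg]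
    erw [stepAux_popBit, stepAux_popBit, stepAux_popBit]
    rfl
  rw [h2, hv', store_step, hv]

/-- A control function given by primitive recursive functions is computed by a code. -/
theorem exists_code_of_primrec {X : Type} [Primcodable X] {next : Option Bool → X → TapeOp × X}
    (hn : Primrec₂ next) : ∃ c : Code, ∀ r x,
      c.eval [Encodable.encode r, Encodable.encode x] =
        pure [(next r x).1.1.toNat, (next r x).1.2.1.toNat, (next r x).1.2.2.toNat,
          Encodable.encode (next r x).2] := by
  -- Each component of the result gets its own code with a single number as output; `Code.cons`
  -- assembles the four. The default `0` only concerns numbers that code no state.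
  have key : ∀ g : TapeOp × X → ℕ, Primrec g → ∃ c : Code, ∀ r x,
      c.eval [Encodable.encode r, Encodable.encode x] = pure [g (next r x)] := by
    intro g hg
    have h1 : Primrec fun v : List.Vector ℕ 2 =>
        (((Encodable.decode (α := Option Bool) v.head).bind fun r =>
          (Encodable.decode (α := X) v.tail.head).map fun x => g (next r x)).getD 0) := by
      refine Primrec.option_getD.comp (Primrec.option_bind
        (Primrec.decode.comp Primrec.vector_head) ?_) (Primrec.const 0)
      refine Primrec.option_map (Primrec.decode.comp
        (Primrec.vector_head.comp (Primrec.vector_tail.comp Primrec.fst))) ?_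
      exact hg.comp (hn.comp (Primrec.snd.comp Primrec.fst) Primrec.snd)
    obtain ⟨c, hc⟩ := Code.exists_code (Nat.Partrec'.of_prim h1)
    refine ⟨c, fun r x => ?_⟩
    have := hc ⟨[Encodable.encode r, Encodable.encode x], rfl⟩
    have h2 : (((Encodable.decode (α := Option Bool) (Encodable.encode r)).bind fun r =>
        (Encodable.decode (α := X) (Encodable.encode x)).map fun x => g (next r x)).getD 0) =
        g (next r x) := by simp
    exact this.trans ((congrArg (fun n => (pure <$> Part.some n : Part (List ℕ))) h2).trans
      (by simp))
  have hb : Primrec Bool.toNat := Primrec.dom_bool _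
  obtain ⟨c₁, h₁⟩ := key (fun y => y.1.1.toNat) (hb.comp (Primrec.fst.comp Primrec.fst))
  obtain ⟨c₂, h₂⟩ := key (fun y => y.1.2.1.toNat)
    (hb.comp (Primrec.fst.comp (Primrec.snd.comp Primrec.fst)))
  obtain ⟨c₃, h₃⟩ := key (fun y => y.1.2.2.toNat)
    (hb.comp (Primrec.snd.comp (Primrec.snd.comp Primrec.fst)))
  obtain ⟨c₄, h₄⟩ := key (fun y => Encodable.encode y.2) (Primrec.encode.comp Primrec.snd)
  refine ⟨.cons c₁ (.cons c₂ (.cons c₃ c₄)), fun r x => ?_⟩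
  simp [Code.cons_eval, h₁, h₂, h₃, h₄]

end Turing.PartrecToTM2

open Turing.PartrecToTM2 in
/-- Every program with primitive recursive control is realized by an oracle machine. -/
theorem exists_oracleMachine {X : Type} [Primcodable X] {next : Option Bool → X → TapeOp × X}
    (hn : Primrec₂ next) {x₀ : X} (hx₀ : Encodable.encode x₀ = 0) :
    ∃ M : OracleMachine, ∀ ψ inp i, ∃ t, i ≤ t ∧ (M.run ψ inp t).output =
      ((progStep next ψ inp)^[i] (none, x₀, ⟨0, [], []⟩)).2.2.output := by
  obtain ⟨c, hc⟩ := exists_code_of_primrec hn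
  refine ⟨loopMachine c, fun ψ inp i => ?_⟩
  suffices h : ∃ t, i ≤ t ∧ (loopMachine c).run ψ inp t =
      roundCfg c ((progStep next ψ inp)^[i] (none, x₀, ⟨0, [], []⟩)).1
        (Encodable.encode ((progStep next ψ inp)^[i] (none, x₀, ⟨0, [], []⟩)).2.1)
        ((progStep next ψ inp)^[i] (none, x₀, ⟨0, [], []⟩)).2.2 by
    obtain ⟨t, ht, he⟩ := h
    exact ⟨t, ht, by rw [he]; rfl⟩
  induction i with
  | zero =>
    obtain ⟨t, ht⟩ := init_reaches c ψ inp
    refine ⟨t, Nat.zero_le _, ht.trans ?_⟩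
    simp [hx₀]
  | succ i ih =>
    obtain ⟨t, hit, ht⟩ := ih
    rw [Function.iterate_succ_apply']
    generalize (progStep next ψ inp)^[i] (none, x₀, ⟨0, [], []⟩) = y at ht ⊢
    obtain ⟨s, hs, hs'⟩ := round_reaches c ψ inp y.2.2 (hc y.1 y.2.1)
    refine ⟨s + t, by omega, ?_⟩
    unfold OracleMachine.run at ht ⊢
    rw [Function.iterate_add_apply, ht, hs']
    rfl

/-! ## Primitive recursive codes -/

theorem bits_of_ne_zero {m : ℕ} (hm : m ≠ 0) : Nat.bits m = (m % 2 == 1) :: Nat.bits (m / 2) := by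
  have h := Nat.bits_append_bit (m / 2) (m % 2 == 1) (fun h => by
    have : m = 1 := by omega
    simp [this])
  rw [← h]
  congr 1
  rw [Nat.bit_val]
  rcases Nat.mod_two_eq_zero_or_one m with h | h <;> simp [h] <;> omega

/-- One step of the computation of a binary numeral. -/
def numeralStep (s : ℕ × List Bool) : ℕ × List Bool :=
  if s.1 = 0 then s else (s.1 / 2, (s.1 % 2 == 1) :: s.2)

/-- At most `m` halvings reach `0`, after which further steps are idle. Bounded iteration thus
replaces recursion on `m / 2`. -/
theorem iterate_numeralStep {m k : ℕ} (h : m ≤ k) (w : List Bool) :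
    (numeralStep^[k] (m, w)).2 = (Nat.bits m).reverse ++ w := by
  induction k generalizing m w with
  | zero => obtain rfl : m = 0 := by omega
            simp
  | succ k ih =>
    rw [Function.iterate_succ_apply]
    rcases eq_or_ne m 0 with rfl | hm
    · exact ih (Nat.zero_le k) w
    · rw [numeralStep, if_neg hm, ih (by simp; omega), bits_of_ne_zero hm]
      simp

theorem primrec_numeralStep : Primrec numeralStep :=
  Primrec.ite (Primrec.eq.comp Primrec.fst (Primrec.const 0)) Primrec.id
    (Primrec.pair (Primrec.nat_div.comp Primrec.fst (Primrec.const 2))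
      (Primrec.list_cons.comp (Primrec.beq.comp (Primrec.nat_mod.comp Primrec.fst
        (Primrec.const 2)) (Primrec.const 1)) Primrec.snd))

theorem primrec_numeral : Primrec fun n : ℕ => (Nat.bits n).reverse := by
  refine (Primrec.snd.comp (Primrec.nat_iterate Primrec.id
    (Primrec.pair Primrec.id (Primrec.const [])) (primrec_numeralStep.comp Primrec.snd).to₂)).of_eq
    fun n => ?_
  simpa using iterate_numeralStep le_rfl []

/-- Integers are carried as differences of naturals throughout. In either sign case the truncated
subtraction involved is exact. -/
theorem primrec_bin_sub : Primrec fun z : ℕ × ℕ => bin ((z.1 : ℤ) - z.2) := by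
  have h1 : Primrec fun z : ℕ × ℕ => z.1 - z.2 := Primrec.nat_sub.comp Primrec.fst Primrec.snd
  have h2 : Primrec fun z : ℕ × ℕ => (1 + z.2) - z.1 :=
    Primrec.nat_sub.comp (Primrec.nat_add.comp (Primrec.const 1) Primrec.snd) Primrec.fst
  refine (Primrec.ite (c := fun z : ℕ × ℕ => z.2 < z.1) (Primrec.nat_lt.comp Primrec.snd Primrec.fst)
    (primrec_numeral.comp h1)
    (Primrec.list_cons.comp (Primrec.const false)
      (Primrec.list_tail.comp (primrec_numeral.comp h2)))).of_eq fun z => ?_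
  unfold bin
  by_cases h : z.2 < z.1
  · rw [if_pos h, if_pos (by omega)]
    congr 2
    omega
  · rw [if_neg h, if_neg (by omega)]
    congr 4
    omega

theorem primrec_selfDelim : Primrec selfDelim :=
  Primrec.list_append.comp (Primrec.list_flatMap Primrec.id
    (Primrec.list_cons.comp (Primrec.const true)
      (Primrec.list_cons.comp Primrec.snd (Primrec.const []))).to₂) (Primrec.const [false])

/-! ## A program that approximates a real number from more and more data -/

/-- The data gathered by the program: the index of the next approximation, initial segments of the two
inputs, and the oracle answers for an initial segment of all words. -/
abbrev Gathered := ℕ × List Bool × List Bool × List (List Bool)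

/-- The `t`-th word queried by the program. -/
def queryWord (t : ℕ) : List Bool := (Encodable.decode (α := List Bool) t).getD []

/-- The data gathered after `t` rounds. -/
def gathered (φ : List Bool → List Bool) (p q : ℕ → Bool) (n t : ℕ) : Gathered :=
  (n, (List.range t).map p, (List.range t).map q, (List.range t).map fun i => φ (queryWord i))

/-- A state of the program: a program position, a word register, and the gathered data. -/
abbrev GatherState := ℕ × List Bool × Gathered

section Gather

variable (G : Gathered → Option (ℕ × ℕ))

/-- The output of a round and the new data. -/
def flushData (C : Gathered) : List Bool × Gathered :=
  match G C with
  | none => ([], C)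
  | some z => (selfDelim (bin ((z.1 : ℤ) - z.2)), C.1 + 1, C.2)

/-- The control function of the program on initialized states. -/
def gatherStep (x : Option Bool × GatherState) : TapeOp × GatherState :=
  let r := x.1
  let w := x.2.2.1
  let C := x.2.2.2
  -- Position `0` writes pending output and then begins a round, `1` and `2` store a bit of each
  -- input, `3` pushes the query, `4` starts and `5` continues popping the answer. Every position
  -- first digests the bit read by the previous access.
  if x.2.1 = 0 then
    match w with
    | [] => (TapeOp.read, 1, [], C)
    | b :: w => (TapeOp.write b, 0, w, C)
  else if x.2.1 = 1 then
    (TapeOp.read, 2, [], C.1, C.2.1 ++ [r.getD false], C.2.2)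
  else if x.2.1 = 2 then
    -- Reversed, because a push writes in front of the query tape.
    (TapeOp.clear, 3, (queryWord C.2.2.2.length).reverse,
      C.1, C.2.1, C.2.2.1 ++ [r.getD false], C.2.2.2)
  else if x.2.1 = 3 then
    match w with
    | [] => (TapeOp.ask, 4, [], C)
    | b :: w => (TapeOp.push b, 3, w, C)
  else if x.2.1 = 4 then (TapeOp.pop, 5, [], C)
  else
    match r with
    | none => (TapeOp.clear, 0, flushData G (C.1, C.2.1, C.2.2.1, C.2.2.2 ++ [w]))
    | some b => (TapeOp.pop, 5, w ++ [b], C)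

/-- The control function of the program. -/
def gatherNext (r : Option Bool) (s : Option GatherState) : TapeOp × Option GatherState :=
  -- `none` plays the initial state because its code is `0`, as `exists_oracleMachine` demands.
  let y := gatherStep G (r, s.getD (0, [], 0, [], [], []))
  (y.1, some y.2)

variable {G}

theorem primrec_queryWord : Primrec queryWord :=
  Primrec.option_getD.comp Primrec.decode (Primrec.const [])

theorem primrec_flushData (hG : Primrec G) : Primrec (flushData G) := by
  refine (Primrec.option_casesOn (o := G) (f := fun C => (([] : List Bool), C))
    (g := fun C z => (selfDelim (bin ((z.1 : ℤ) - z.2)), C.1 + 1, C.2)) hG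
    (Primrec.pair (Primrec.const []) Primrec.id) ?_).of_eq fun C => ?_
  · exact Primrec.pair (primrec_selfDelim.comp (primrec_bin_sub.comp Primrec.snd))
      (Primrec.pair (Primrec.succ.comp (Primrec.fst.comp Primrec.fst))
        (Primrec.snd.comp Primrec.fst))
  · unfold flushData
    cases G C <;> rfl

theorem primrec_gatherStep (hG : Primrec G) : Primrec (gatherStep G) := by
  have hr : Primrec fun x : Option Bool × GatherState => x.1 := Primrec.fst
  have hk : Primrec fun x : Option Bool × GatherState => x.2.1 := Primrec.fst.comp Primrec.snd
  have hw : Primrec fun x : Option Bool × GatherState => x.2.2.1 :=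
    Primrec.fst.comp (Primrec.snd.comp Primrec.snd)
  have hC : Primrec fun x : Option Bool × GatherState => x.2.2.2 :=
    Primrec.snd.comp (Primrec.snd.comp Primrec.snd)
  have hC0 : Primrec fun x : Option Bool × GatherState => x.2.2.2.1 := Primrec.fst.comp hC
  have hC1 : Primrec fun x : Option Bool × GatherState => x.2.2.2.2 := Primrec.snd.comp hC
  have hP : Primrec fun x : Option Bool × GatherState => x.2.2.2.2.1 := Primrec.fst.comp hC1
  have hC2 : Primrec fun x : Option Bool × GatherState => x.2.2.2.2.2 := Primrec.snd.comp hC1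
  have hQ : Primrec fun x : Option Bool × GatherState => x.2.2.2.2.2.1 := Primrec.fst.comp hC2
  have hR : Primrec fun x : Option Bool × GatherState => x.2.2.2.2.2.2 := Primrec.snd.comp hC2
  have hb : Primrec fun x : Option Bool × GatherState => x.1.getD false :=
    Primrec.option_getD.comp hr (Primrec.const false)
  have heq : ∀ n : ℕ, PrimrecPred fun x : Option Bool × GatherState => x.2.1 = n := fun n =>
    Primrec.eq.comp hk (Primrec.const n)
  have hl : ∀ (f : Bool → TapeOp) (a b : ℕ) (o : TapeOp),
      Primrec fun x : Option Bool × GatherState =>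
        (List.casesOn x.2.2.1 (o, a, [], x.2.2.2) fun c w => (f c, b, w, x.2.2.2) :
          TapeOp × GatherState) := fun f a b o => by
    refine Primrec.list_casesOn
      (h := fun x y => ((f y.1, b, y.2, x.2.2.2) : TapeOp × GatherState))
      hw (Primrec.pair (Primrec.const o)
      (Primrec.pair (Primrec.const a) (Primrec.pair (Primrec.const []) hC))) ?_
    exact Primrec.pair ((Primrec.dom_bool f).comp (Primrec.fst.comp Primrec.snd))
      (Primrec.pair (Primrec.const b) (Primrec.pair (Primrec.snd.comp Primrec.snd)
        (hC.comp Primrec.fst)))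
  have h5 : Primrec fun x : Option Bool × GatherState =>
      (Option.casesOn x.1 (TapeOp.clear, 0, flushData G (x.2.2.2.1, x.2.2.2.2.1,
        x.2.2.2.2.2.1, x.2.2.2.2.2.2 ++ [x.2.2.1])) fun b =>
        (TapeOp.pop, 5, x.2.2.1 ++ [b], x.2.2.2) : TapeOp × GatherState) := by
    refine Primrec.option_casesOn hr (Primrec.pair (Primrec.const _)
      (Primrec.pair (Primrec.const 0) ((primrec_flushData hG).comp
        (Primrec.pair hC0 (Primrec.pair hP (Primrec.pair hQ
          (Primrec.list_concat.comp hR hw))))))) ?_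
    exact Primrec.pair (Primrec.const _) (Primrec.pair (Primrec.const 5) (Primrec.pair
      (Primrec.list_concat.comp (hw.comp Primrec.fst) Primrec.snd) (hC.comp Primrec.fst)))
  have h2 := primrec_queryWord.comp (Primrec.list_length.comp hR)
  refine (Primrec.ite (heq 0) (hl TapeOp.write 1 0 TapeOp.read) <|
    Primrec.ite (heq 1) (Primrec.pair (Primrec.const TapeOp.read) (Primrec.pair (Primrec.const 2)
      (Primrec.pair (Primrec.const []) (Primrec.pair hC0 (Primrec.pair
        (Primrec.list_concat.comp hP hb) hC2))))) <|
    Primrec.ite (heq 2) (Primrec.pair (Primrec.const TapeOp.clear) (Primrec.pair (Primrec.const 3)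
      (Primrec.pair (Primrec.list_reverse.comp h2) (Primrec.pair hC0 (Primrec.pair hP (Primrec.pair
        (Primrec.list_concat.comp hQ hb) hR)))))) <|
    Primrec.ite (heq 3) (hl TapeOp.push 4 3 TapeOp.ask) <|
    Primrec.ite (heq 4) (Primrec.pair (Primrec.const TapeOp.pop) (Primrec.pair (Primrec.const 5)
      (Primrec.pair (Primrec.const []) hC))) h5).of_eq fun x => ?_
  obtain ⟨r, k, w, C⟩ := x
  unfold gatherStep
  cases r <;> cases w <;> rfl

theorem primrec_gatherNext (hG : Primrec G) : Primrec₂ (gatherNext G) := by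
  have h : Primrec fun x : Option Bool × Option GatherState =>
      gatherStep G (x.1, x.2.getD (0, [], 0, [], [], [])) :=
    (primrec_gatherStep hG).comp (Primrec.pair Primrec.fst
      (Primrec.option_getD.comp Primrec.snd (Primrec.const _)))
  exact Primrec.pair (Primrec.fst.comp h) (Primrec.option_some.comp (Primrec.snd.comp h))

variable (φ : List Bool → List Bool) (inp : ℕ → Option Bool)

local notation "pstep" => progStep (gatherNext G) φ inp

theorem gather_push_loop (r : Option Bool) (w : List Bool) (C : Gathered) (k : ℕ)
    (v out : List Bool) : ∃ i, (pstep)^[i] (r, some (3, w, C), ⟨k, v, out⟩) =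
      (none, some (4, [], C), ⟨k, φ (w.reverse ++ v), out⟩) := by
  induction w generalizing r v with
  | nil => exact ⟨1, rfl⟩
  | cons b w ih =>
    obtain ⟨i, hi⟩ := ih none (b :: v)
    refine ⟨i + 1, ?_⟩
    rw [Function.iterate_succ_apply]
    exact hi.trans (by simp)

theorem gather_pop_loop (w v : List Bool) (C : Gathered) (k : ℕ) (out : List Bool) :
    ∃ i, (pstep)^[i] (v.head?, some (5, w, C), ⟨k, v.tail, out⟩) =
      (none, some (0, flushData G (C.1, C.2.1, C.2.2.1, C.2.2.2 ++ [w ++ v])), ⟨k, [], out⟩) := by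
  induction v generalizing w with
  | nil => exact ⟨1, by simp [progStep, gatherNext, gatherStep, Tapes.exec]⟩
  | cons b v ih =>
    obtain ⟨i, hi⟩ := ih (w ++ [b])
    refine ⟨i + 1, ?_⟩
    rw [Function.iterate_succ_apply]
    exact hi.trans (by simp)

theorem gather_write_loop (w : List Bool) (C : Gathered) (k : ℕ) (v out : List Bool) :
    ∃ i, (pstep)^[i] (none, some (0, w, C), ⟨k, v, out⟩) =
      (none, some (0, [], C), ⟨k, v, out ++ w⟩) := by
  induction w generalizing out with
  | nil => exact ⟨0, by simp⟩
  | cons b w ih =>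
    obtain ⟨i, hi⟩ := ih (out ++ [b])
    refine ⟨i + 1, ?_⟩
    rw [Function.iterate_succ_apply]
    exact hi.trans (by simp)

theorem gather_round (C : Gathered) (k : ℕ) (v out : List Bool) :
    let y := flushData G (C.1, C.2.1 ++ [(inp k).getD false], C.2.2.1 ++ [(inp (k + 1)).getD false],
      C.2.2.2 ++ [φ (queryWord C.2.2.2.length)])
    ∃ i, (pstep)^[i + 1] (none, some (0, [], C), ⟨k, v, out⟩) =
      (none, some (0, [], y.2), ⟨k + 2, [], out ++ y.1⟩) := by
  intro y
  obtain ⟨i₁, h₁⟩ := gather_push_loop (G := G) φ inp none (queryWord C.2.2.2.length).reverse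
    (C.1, C.2.1 ++ [(inp k).getD false], C.2.2.1 ++ [(inp (k + 1)).getD false], C.2.2.2)
    (k + 2) [] out
  rw [List.reverse_reverse, List.append_nil] at h₁
  obtain ⟨i₂, h₂⟩ := gather_pop_loop (G := G) φ inp [] (φ (queryWord C.2.2.2.length))
    (C.1, C.2.1 ++ [(inp k).getD false], C.2.2.1 ++ [(inp (k + 1)).getD false], C.2.2.2)
    (k + 2) out
  obtain ⟨i₃, h₃⟩ := gather_write_loop (G := G) φ inp y.1 y.2 (k + 2) [] out
  refine ⟨i₃ + (i₂ + (1 + (i₁ + 2))), ?_⟩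
  have e : (pstep)^[3] (none, some (0, [], C), ⟨k, v, out⟩) = (none, some (3,
      (queryWord C.2.2.2.length).reverse, C.1, C.2.1 ++ [(inp k).getD false],
      C.2.2.1 ++ [(inp (k + 1)).getD false], C.2.2.2), ⟨k + 2, [], out⟩) := rfl
  have e4 : ∀ C : Gathered, pstep (none, some (4, [], C), ⟨k + 2, φ (queryWord C.2.2.2.length), out⟩) =
    ((φ (queryWord C.2.2.2.length)).head?, some (5, [], C), ⟨k + 2,
      (φ (queryWord C.2.2.2.length)).tail, out⟩) := fun _ => rfl
  rw [show i₃ + (i₂ + (1 + (i₁ + 2))) + 1 = i₃ + (i₂ + (1 + (i₁ + 3))) by ring,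
    Function.iterate_add_apply, Function.iterate_add_apply _ i₂, Function.iterate_add_apply _ 1,
    Function.iterate_add_apply _ i₁, e, h₁, Function.iterate_one]
  erw [e4, h₂]
  exact h₃

end Gather

section Rounds

variable (G : Gathered → Option (ℕ × ℕ)) (φ : List Bool → List Bool) (p q : ℕ → Bool)

/-- The numerators written in the first `t` rounds. -/
def written : ℕ → List ℤ
  | 0 => []
  | t + 1 => written t ++
      ((G (gathered φ p q (written t).length (t + 1))).map fun z => ((z.1 : ℤ) - z.2)).toList

theorem flushData_gathered (t : ℕ) :
    flushData G (gathered φ p q (written G φ p q t).length (t + 1)) =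
      (((G (gathered φ p q (written G φ p q t).length (t + 1))).map fun z =>
          ((z.1 : ℤ) - z.2)).toList.flatMap fun z => selfDelim (bin z),
        gathered φ p q (written G φ p q (t + 1)).length (t + 1)) := by
  rw [written]
  unfold flushData
  cases G (gathered φ p q (written G φ p q t).length (t + 1)) <;> simp [gathered]

/-- Compared one step late: the run starts in `none`, which differs from the initialized state until
the first step is made. The bound `t ≤ i` makes the rounds cover arbitrarily late times. -/
theorem gather_rounds (t : ℕ) : ∃ i, t ≤ i ∧ ∃ v,
    (progStep (gatherNext G) φ fun j => some (interleave p q j))^[i + 1]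
        (none, none, ⟨0, [], []⟩) =
      progStep (gatherNext G) φ (fun j => some (interleave p q j))
        (none, some (0, [], gathered φ p q (written G φ p q t).length t),
          ⟨2 * t, v, (written G φ p q t).flatMap fun z => selfDelim (bin z)⟩) := by
  induction t with
  | zero => exact ⟨0, le_rfl, [], rfl⟩
  | succ t ih =>
    obtain ⟨i, hi, v, h⟩ := ih
    obtain ⟨j, hj⟩ := gather_round (G := G) φ (fun j => some (interleave p q j))
      (gathered φ p q (written G φ p q t).length t) (2 * t) v
      ((written G φ p q t).flatMap fun z => selfDelim (bin z))
    have hp : interleave p q (2 * t) = p t := by simp [interleave]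
    have hq : interleave p q (2 * t + 1) = q t := by
      simp [interleave, Nat.add_mod, Nat.mul_add_div]
    have hg : ((gathered φ p q (written G φ p q t).length t).1,
        (gathered φ p q (written G φ p q t).length t).2.1 ++ [p t],
        (gathered φ p q (written G φ p q t).length t).2.2.1 ++ [q t],
        (gathered φ p q (written G φ p q t).length t).2.2.2 ++ [φ (queryWord t)]) =
        gathered φ p q (written G φ p q t).length (t + 1) := by
      simp [gathered, List.range_succ]
    have hl : (gathered φ p q (written G φ p q t).length t).2.2.2.length = t := by
      simp [gathered]
    simp only [hp, hq, hl, Option.getD_some] at hj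
    rw [hg, flushData_gathered] at hj
    refine ⟨j + 1 + i, by omega, [], ?_⟩
    rw [show j + 1 + i + 1 = (j + 1) + (i + 1) by ring, Function.iterate_add_apply, h,
      ← Function.iterate_succ_apply, Function.iterate_succ_apply', hj]
    simp [written, mul_add]

theorem written_mono {s t : ℕ} (h : s ≤ t) : written G φ p q s <+: written G φ p q t := by
  induction t, h using Nat.le_induction with
  | base => exact List.prefix_rfl
  | succ t _ ih => exact ih.trans (List.prefix_append _ _)

end Rounds

theorem OracleMachine.output_run_prefix (M : OracleMachine) (ψ : List Bool → List Bool)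
    (inp : ℕ → Option Bool) {s t : ℕ} (h : s ≤ t) :
    (M.run ψ inp s).output <+: (M.run ψ inp t).output := by
  induction t, h using Nat.le_induction with
  | base => exact List.prefix_rfl
  | succ t _ ih =>
    refine ih.trans ?_
    rw [M.run_succ]
    unfold OracleMachine.step
    split
    · exact List.prefix_rfl
    · split <;> simp

/-- A real operator is computable if approximations can be extracted primitive recursively from
sufficiently large finite parts of the inputs. -/
theorem computableOperator_of_approx {F : Set (I → ℝ)} {op : (I → ℝ) → I → I → ℝ}
    {G : Gathered → Option (ℕ × ℕ)} (hG : Primrec G)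
    (sound : ∀ f ∈ F, ∀ (u v : I) φ p q, IsLipName φ f → IsRealName p u → IsRealName q v →
      ∀ n t, ∀ z ∈ G (gathered φ p q n t),
        |op f u v - ((z.1 : ℝ) - z.2) / 2 ^ (n + 1)| ≤ (2 ^ n : ℝ)⁻¹)
    (live : ∀ f ∈ F, ∀ (u v : I) φ p q, IsLipName φ f → IsRealName p u → IsRealName q v →
      ∀ n, ∃ t₀, ∀ t ≥ t₀, (G (gathered φ p q n t)).isSome) :
    ComputableOperator F op := by
  obtain ⟨M, hM⟩ := exists_oracleMachine (primrec_gatherNext hG) (x₀ := none) rfl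
  refine ⟨M, fun f hf u v φ p q hφ hp hq => ?_⟩
  specialize sound f hf u v φ p q hφ hp hq
  specialize live f hf u v φ p q hφ hp hq
  set W := written G φ p q with hW
  -- Output cannot stall: if the length stayed at `n`, then `live n` would eventually force another
  -- numerator.
  have hlen : ∀ n, ∃ t, n ≤ (W t).length := by
    intro n
    induction n with
    | zero => exact ⟨0, Nat.zero_le _⟩
    | succ n ih =>
      obtain ⟨t, ht⟩ := ih
      by_contra! hcon
      obtain ⟨t₀, h₀⟩ := live n
      have hle : (W t).length ≤ (W (max t t₀)).length :=
        (written_mono G φ p q (le_max_left t t₀)).length_le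
      have heq : (W (max t t₀)).length = n := by
        have := hcon (max t t₀)
        omega
      have h1 := hcon (max t t₀ + 1)
      have h2 := h₀ (max t t₀ + 1) (by omega)
      obtain ⟨z, hz⟩ := Option.isSome_iff_exists.1 h2
      rw [hW, written, ← hW, heq, hz] at h1
      simp [heq] at h1
  choose S hS using fun n => hlen (n + 1)
  let a : ℕ → ℤ := fun n => (W (S n)).getD n 0
  have hWa : ∀ t, W t = (List.range (W t).length).map a := by
    intro t
    refine List.ext_getElem (by simp) fun n h1 h2 => ?_
    have h3 : n < (W (S n)).length := hS n
    simp only [List.getElem_map, List.getElem_range, a, List.getD_eq_getElem _ _ h3]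
    rcases le_total t (S n) with h | h
    · exact (written_mono G φ p q h).getElem h1
    · exact ((written_mono G φ p q h).getElem h3).symm
  have hcode : ∀ t, (W t).flatMap (fun z => selfDelim (bin z)) = seqCode a (W t).length := by
    intro t
    conv_lhs => rw [hWa t]
    rw [seqCode, List.flatMap_map]
  -- An entry was appended when its index equalled the length of the list, which is exactly the `n`
  -- passed to `G`.
  have happrox : ∀ t n (h : n < (W t).length),
      |op f u v - ((W t)[n] : ℝ) / 2 ^ (n + 1)| ≤ (2 ^ n : ℝ)⁻¹ := by
    intro t
    induction t with
    | zero => intro n h; simp [hW, written] at h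
    | succ t ih =>
      intro n h
      have hs : W (t + 1) = W t ++ ((G (gathered φ p q (W t).length (t + 1))).map
        fun z => ((z.1 : ℤ) - z.2)).toList := rfl
      rcases lt_or_ge n (W t).length with h1 | h1
      · simp only [hs, List.getElem_append_left h1]
        exact ih n h1
      · rcases hz : G (gathered φ p q (W t).length (t + 1)) with _ | z
        · rw [hs, hz] at h
          simp at h
          omega
        · have hn : n = (W t).length := by
            rw [hs, hz] at h
            simp at h
            omega
          have := sound _ _ z hz
          subst hn
          simpa [hs, hz] using this
  obtain ⟨τ, hτ⟩ := exists_encodesSeq a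
  -- At arbitrarily late times the output consists of complete codes. At other times it is a prefix
  -- of such an output.
  have hout : ∀ m, ∃ t, m ≤ t ∧ ∃ n, m ≤ n ∧
      (M.run φ (fun i => some (interleave p q i)) t).output = seqCode a n := by
    intro m
    obtain ⟨s, hs⟩ := hlen m
    obtain ⟨i, hi, w, h⟩ := gather_rounds G φ p q (max m s)
    obtain ⟨t, ht, ht'⟩ := hM φ (fun i => some (interleave p q i)) (i + 1)
    refine ⟨t, by omega, (W (max m s)).length,
      hs.trans (written_mono G φ p q (le_max_right m s)).length_le, ?_⟩
    rw [ht', h, ← hcode]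
    rfl
  refine ⟨τ, ⟨fun t => ?_, fun n => ?_⟩, a, hτ, fun n => ?_⟩
  · obtain ⟨t', ht', n, -, hn⟩ := hout t
    have h1 := M.output_run_prefix φ (fun i => some (interleave p q i)) ht'
    have h2 := h1.length_le
    rw [List.prefix_iff_eq_take, hn, hτ n, ← List.map_take, List.take_range] at h1
    rw [hn] at h2
    rw [min_eq_left h2] at h1
    exact h1
  · obtain ⟨t, -, m, hm, h⟩ := hout n
    exact ⟨t, by rw [h]; exact hm.trans (le_length_seqCode a m)⟩
  · have h1 := happrox (S n) n (hS n)
    have h2 : a n = (W (S n))[n]'(hS n) := List.getD_eq_getElem _ _ (hS n)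
    rwa [h2]

/-! ## Extracting tables of function values from oracle answers -/

theorem primrec_pow : Primrec₂ ((· ^ ·) : ℕ → ℕ → ℕ) := Primrec₂.unpaired'.1 Nat.Primrec.pow

theorem primrec_natVal : Primrec natVal := by
  refine (Primrec.list_foldl (h := fun _ y => 2 * y.1 + y.2.toNat) Primrec.id (Primrec.const 0)
    (Primrec.nat_add.comp (Primrec.nat_mul.comp (Primrec.const 2)
      (Primrec.fst.comp Primrec.snd)) ((Primrec.dom_bool Bool.toNat).comp
        (Primrec.snd.comp Primrec.snd))).to₂).of_eq fun w => ?_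
  simp only [natVal, Nat.bit_val, id]

theorem primrec_binNat : Primrec binNat :=
  Primrec.ite (Primrec.eq.comp Primrec.list_head? (Primrec.const _)) primrec_natVal (Primrec.const 0)

theorem primrec_scanStep : Primrec₂ scanStep := by
  have h : Primrec fun x : (Bool × List Bool × List (List Bool)) × Bool => x.1.2.1 :=
    Primrec.fst.comp (Primrec.snd.comp Primrec.fst)
  have h' : Primrec fun x : (Bool × List Bool × List (List Bool)) × Bool => x.1.2.2 :=
    Primrec.snd.comp (Primrec.snd.comp Primrec.fst)
  exact Primrec.ite (Primrec.eq.comp (Primrec.fst.comp Primrec.fst) (Primrec.const true))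
    (Primrec.pair (Primrec.const _) (Primrec.pair (Primrec.list_concat.comp h Primrec.snd) h'))
    (Primrec.ite (Primrec.eq.comp Primrec.snd (Primrec.const true))
      (Primrec.pair (Primrec.const _) (Primrec.pair h h'))
      (Primrec.pair (Primrec.const _) (Primrec.pair (Primrec.const _)
        (Primrec.list_concat.comp h' h))))

theorem primrec_scan : Primrec scan :=
  Primrec.snd.comp (Primrec.snd.comp (Primrec.list_foldl Primrec.id (Primrec.const _)
    (primrec_scanStep.comp (Primrec.fst.comp Primrec.snd) (Primrec.snd.comp Primrec.snd)).to₂))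

/-- One step of the computation of `wordOf`. -/
def wordOfStep (s : ℕ × List Bool) : ℕ × List Bool := (s.1 / 2, (s.1 % 2 == 1) :: s.2)

theorem iterate_wordOfStep (k i : ℕ) (w : List Bool) :
    (wordOfStep^[k] (i, w)).2 = wordOf k i ++ w := by
  induction k generalizing i w with
  | zero => rfl
  | succ k ih =>
    rw [Function.iterate_succ_apply, wordOfStep, ih, wordOf]
    simp

theorem primrec_wordOf : Primrec₂ wordOf := by
  have h : Primrec wordOfStep := Primrec.pair (Primrec.nat_div.comp Primrec.fst (Primrec.const 2))
    (Primrec.list_cons.comp (Primrec.beq.comp (Primrec.nat_mod.comp Primrec.fst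
      (Primrec.const 2)) (Primrec.const 1)) Primrec.snd)
  refine (Primrec.snd.comp (Primrec.nat_iterate (f := Prod.fst) (g := fun x : ℕ × ℕ => (x.2, []))
    Primrec.fst (Primrec.pair Primrec.snd (Primrec.const []))
    (h.comp Primrec.snd).to₂)).of_eq fun x => ?_
  simpa using iterate_wordOfStep x.1 x.2 []

/-- The first component of a pairing. -/
def firstWord (r : List Bool) : List Bool := (scan r).headI

/-- The second component of a pairing. -/
def secondWord (r : List Bool) : List Bool := r.drop (2 * (firstWord r).length + 1)

theorem firstWord_pairWord (u v : List Bool) : firstWord (pairWord u v) = u := by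
  have h := head?_scan_pairWord u v
  unfold firstWord
  cases hs : scan (pairWord u v) <;> simp_all

theorem secondWord_pairWord (u v : List Bool) : secondWord (pairWord u v) = v := by
  unfold secondWord
  rw [firstWord_pairWord, pairWord, ← selfDelim_length, List.drop_left]

theorem primrec_firstWord : Primrec firstWord := Primrec.list_headI.comp primrec_scan

theorem primrec_secondWord : Primrec secondWord :=
  Primrec.list_drop.comp (Primrec.succ.comp (Primrec.nat_mul.comp (Primrec.const 2)
    (Primrec.list_length.comp primrec_firstWord))) Primrec.id

theorem natVal_bin (l : ℕ) : natVal (bin (l : ℤ)) = l := by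
  rcases Nat.eq_zero_or_pos l with rfl | h
  · simp [bin, natVal]
  · rw [bin, if_pos (by exact_mod_cast h), Int.toNat_natCast, natVal_reverse_bits]

/-- The integer denoted by a word with sign bit, as a difference. -/
def intPair (w : List Bool) : ℕ × ℕ :=
  if w.head? = some true then (natVal w.tail, 0) else (0, natVal w.tail)

theorem intPair_spec (w : List Bool) : ((intPair w).1 : ℤ) - (intPair w).2 = intVal w := by
  rcases w with _ | ⟨_ | _, w⟩ <;> simp [intPair, intVal, natVal]

theorem primrec_intPair : Primrec intPair := by
  have h := primrec_natVal.comp (Primrec.list_tail (α := Bool))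
  exact Primrec.ite (Primrec.eq.comp Primrec.list_head? (Primrec.const _))
    (Primrec.pair h (Primrec.const 0)) (Primrec.pair (Primrec.const 0) h)

theorem natVal_tail_eq (w : List Bool) : (natVal w.tail : ℤ) = |intVal w| := by
  rcases w with _ | ⟨_ | _, w⟩ <;> simp [intVal, natVal]

/-- The answer to the query `w`, if it is available. -/
def answer (R : List (List Bool)) (w : List Bool) : Option (List Bool) := R[Encodable.encode w]?

theorem primrec_answer : Primrec₂ answer :=
  Primrec.list_getElem?.comp Primrec.fst (Primrec.encode.comp Primrec.snd)

/-- The first `i` entries of the table of function values at arguments of precision `k`. -/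
def tableAux (R : List (List Bool)) (k : ℕ) : ℕ → Option (List (ℕ × ℕ))
  | 0 => some []
  | i + 1 => (tableAux R k i).bind fun L =>
      (answer R (wordOf k i)).map fun r => L ++ [intPair (secondWord r)]

theorem primrec_tableAux :
    Primrec fun x : List (List Bool) × ℕ => tableAux x.1 x.2 (2 ^ x.2) := by
  refine (Primrec.nat_rec' (f := fun x : List (List Bool) × ℕ => 2 ^ x.2)
    (g := fun _ => some []) (h := fun x y => y.2.bind fun L =>
      (answer x.1 (wordOf x.2 y.1)).map fun r => L ++ [intPair (secondWord r)])
    (primrec_pow.comp (Primrec.const 2) Primrec.snd) (Primrec.const _) ?_).of_eq fun x => ?_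
  · refine Primrec.option_bind (Primrec.snd.comp Primrec.snd) ?_
    refine Primrec.option_map (primrec_answer.comp
      (Primrec.fst.comp (Primrec.fst.comp Primrec.fst))
      (primrec_wordOf.comp (Primrec.snd.comp (Primrec.fst.comp Primrec.fst))
        (Primrec.fst.comp (Primrec.snd.comp Primrec.fst)))) ?_
    exact Primrec.list_concat.comp (Primrec.snd.comp Primrec.fst)
      (primrec_intPair.comp (primrec_secondWord.comp Primrec.snd))
  · generalize 2 ^ x.2 = m
    induction m with
    | zero => rfl
    | succ m ih => simp only [tableAux, ← ih]

/-- The precision at which the function is evaluated, given the answer to the empty query. -/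
def precision (n : ℕ) (r : List Bool) : ℕ :=
  n + natVal (firstWord r) + natVal (secondWord r).tail + 4

theorem primrec_precision : Primrec₂ precision :=
  Primrec.nat_add.comp (Primrec.nat_add.comp (Primrec.nat_add.comp Primrec.fst
    (primrec_natVal.comp (primrec_firstWord.comp Primrec.snd)))
    (primrec_natVal.comp (Primrec.list_tail.comp (primrec_secondWord.comp Primrec.snd))))
    (Primrec.const 4)

/-- The numerator of the `k`-th approximation of a nonnegative real number. -/
def realApprox (P : List Bool) (k : ℕ) : Option ℕ := ((scan P)[k]?).map binNat

theorem primrec_realApprox : Primrec₂ realApprox :=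
  Primrec.option_map (Primrec.list_getElem?.comp (primrec_scan.comp Primrec.fst) Primrec.snd)
    (primrec_binNat.comp Primrec.snd)

/-! ### Approximating an operator from a finite table of function values. -/

section Table

variable (E : ℕ × ℕ × ℕ × List (ℕ × ℕ) → ℕ × ℕ)

/-- Apply `E` to the table and round to precision `n`. -/
def tableResult (n k A A' : ℕ) (L : List (ℕ × ℕ)) : ℕ × ℕ :=
  ((E (k, min A A', max A A', L)).1 / 2 ^ (2 * k - n), (E (k, min A A', max A A', L)).2 / 2 ^ (2 * k - n))

/-- The approximation computed by `E` at precision `k` from the numerators of the two real arguments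
and the table. -/
def approxFromTable (C : Gathered) (k A A' : ℕ) : Option (ℕ × ℕ) :=
  (tableAux C.2.2.2 k (2 ^ k)).map fun L => tableResult E C.1 k A A' L

/-- The approximation computed by `E` at precision `k`, given the numerator of the first argument. -/
def approxFromFirst (C : Gathered) (k A : ℕ) : Option (ℕ × ℕ) :=
  (realApprox C.2.2.1 k).bind fun A' => approxFromTable E C k A A'

/-- The approximation computed by `E` at precision `k`. -/
def approxAt (C : Gathered) (k : ℕ) : Option (ℕ × ℕ) :=
  (realApprox C.2.1 k).bind fun A => approxFromFirst E C k A

/-- The approximation computed by `E` from the gathered data. -/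
def tableApprox (C : Gathered) : Option (ℕ × ℕ) :=
  (answer C.2.2.2 []).bind fun r => approxAt E C (precision C.1 r)

variable {E}

theorem primrec_tableResult (hE : Primrec E) :
    Primrec fun x : ℕ × ℕ × ℕ × ℕ × List (ℕ × ℕ) =>
      tableResult E x.1 x.2.1 x.2.2.1 x.2.2.2.1 x.2.2.2.2 := by
  have h1 : Primrec fun x : ℕ × ℕ × ℕ × ℕ × List (ℕ × ℕ) => x.2.1 := Primrec.fst.comp Primrec.snd
  have h2 : Primrec fun x : ℕ × ℕ × ℕ × ℕ × List (ℕ × ℕ) => x.2.2 := Primrec.snd.comp Primrec.snd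
  have h3 : Primrec fun x : ℕ × ℕ × ℕ × ℕ × List (ℕ × ℕ) => x.2.2.1 := Primrec.fst.comp h2
  have h4 : Primrec fun x : ℕ × ℕ × ℕ × ℕ × List (ℕ × ℕ) => x.2.2.2 := Primrec.snd.comp h2
  have h5 : Primrec fun x : ℕ × ℕ × ℕ × ℕ × List (ℕ × ℕ) => x.2.2.2.1 := Primrec.fst.comp h4
  have hz := hE.comp (Primrec.pair h1 (Primrec.pair (Primrec.nat_min.comp h3 h5)
    (Primrec.pair (Primrec.nat_max.comp h3 h5) (Primrec.snd.comp h4))))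
  have hd := primrec_pow.comp (Primrec.const 2)
    (Primrec.nat_sub.comp (Primrec.nat_mul.comp (Primrec.const 2) h1) Primrec.fst)
  exact Primrec.pair (Primrec.nat_div.comp (Primrec.fst.comp hz) hd)
    (Primrec.nat_div.comp (Primrec.snd.comp hz) hd)

theorem primrec_tableApprox (hE : Primrec E) : Primrec (tableApprox E) := by
  have hP : Primrec fun C : Gathered => C.2.1 := Primrec.fst.comp Primrec.snd
  have hQ : Primrec fun C : Gathered => C.2.2.1 := Primrec.fst.comp (Primrec.snd.comp Primrec.snd)
  have hR : Primrec fun C : Gathered => C.2.2.2 := Primrec.snd.comp (Primrec.snd.comp Primrec.snd)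
  have h3 : Primrec fun x : Gathered × ℕ × ℕ × ℕ =>
      approxFromTable E x.1 x.2.1 x.2.2.1 x.2.2.2 := by
    refine Primrec.option_map (primrec_tableAux.comp (Primrec.pair (hR.comp Primrec.fst)
      (Primrec.fst.comp Primrec.snd))) ?_
    have h : Primrec fun y : (Gathered × ℕ × ℕ × ℕ) × List (ℕ × ℕ) => y.1.2.2 :=
      Primrec.snd.comp (Primrec.snd.comp Primrec.fst)
    exact (primrec_tableResult hE).comp (Primrec.pair
      (Primrec.fst.comp (Primrec.fst.comp Primrec.fst)) (Primrec.pair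
        (Primrec.fst.comp (Primrec.snd.comp Primrec.fst)) (Primrec.pair (Primrec.fst.comp h)
          (Primrec.pair (Primrec.snd.comp h) Primrec.snd))))
  have h2 : Primrec fun x : Gathered × ℕ × ℕ => approxFromFirst E x.1 x.2.1 x.2.2 := by
    have hg : Primrec fun y : (Gathered × ℕ × ℕ) × ℕ => (y.1.1, y.1.2.1, y.1.2.2, y.2) :=
      Primrec.pair (Primrec.fst.comp Primrec.fst) (Primrec.pair
        (Primrec.fst.comp (Primrec.snd.comp Primrec.fst)) (Primrec.pair
          (Primrec.snd.comp (Primrec.snd.comp Primrec.fst)) Primrec.snd))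
    have hq : Primrec fun x : Gathered × ℕ × ℕ => realApprox x.1.2.2.1 x.2.1 :=
      primrec_realApprox.comp (hQ.comp Primrec.fst) (Primrec.fst.comp Primrec.snd)
    have hc : Primrec₂ fun (x : Gathered × ℕ × ℕ) (A' : ℕ) =>
        approxFromTable E x.1 x.2.1 x.2.2 A' := (h3.comp hg).to₂
    exact Primrec.option_bind hq hc
  have h1 : Primrec fun x : Gathered × ℕ => approxAt E x.1 x.2 := by
    have hg : Primrec fun y : (Gathered × ℕ) × ℕ => (y.1.1, y.1.2, y.2) :=
      Primrec.pair (Primrec.fst.comp Primrec.fst) (Primrec.pair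
        (Primrec.snd.comp Primrec.fst) Primrec.snd)
    have hq : Primrec fun x : Gathered × ℕ => realApprox x.1.2.1 x.2 :=
      primrec_realApprox.comp (hP.comp Primrec.fst) Primrec.snd
    have hc : Primrec₂ fun (x : Gathered × ℕ) (A : ℕ) => approxFromFirst E x.1 x.2 A :=
      (h2.comp hg).to₂
    exact Primrec.option_bind hq hc
  have hg : Primrec fun y : Gathered × List Bool => (y.1, precision y.1.1 y.2) :=
    Primrec.pair Primrec.fst (primrec_precision.comp (Primrec.fst.comp Primrec.fst) Primrec.snd)
  have ha : Primrec fun C : Gathered => answer C.2.2.2 [] :=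
    primrec_answer.comp hR (Primrec.const _)
  have hc : Primrec₂ fun (C : Gathered) (r : List Bool) => approxAt E C (precision C.1 r) :=
    (h1.comp hg).to₂
  exact Primrec.option_bind ha hc

theorem answer_gathered {φ : List Bool → List Bool} {t : ℕ} {w r : List Bool}
    (h : answer ((List.range t).map fun i => φ (queryWord i)) w = some r) : r = φ w := by
  simp only [answer, List.getElem?_map, Option.map_eq_some_iff] at h
  obtain ⟨i, hi, rfl⟩ := h
  obtain ⟨hi, rfl⟩ := List.getElem?_eq_some_iff.1 hi
  simp [queryWord]

theorem answer_gathered_of_lt (φ : List Bool → List Bool) {t : ℕ} {w : List Bool}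
    (h : Encodable.encode w < t) :
    answer ((List.range t).map fun i => φ (queryWord i)) w = some (φ w) := by
  simp [answer, List.getElem?_range h, queryWord]

theorem tableAux_gathered {φ : List Bool → List Bool} {t k m : ℕ} {L : List (ℕ × ℕ)}
    (h : tableAux ((List.range t).map fun i => φ (queryWord i)) k m = some L) :
    L = (List.range m).map fun i => intPair (secondWord (φ (wordOf k i))) := by
  induction m generalizing L with
  | zero => simpa [tableAux] using h.symm
  | succ m ih =>
    simp only [tableAux, Option.bind_eq_some_iff, Option.map_eq_some_iff] at h
    obtain ⟨L', hL', r, hr, rfl⟩ := h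
    rw [ih hL', answer_gathered hr, List.range_succ]
    simp

theorem isSome_tableAux_gathered (φ : List Bool → List Bool) {t k m : ℕ}
    (h : ∀ i < m, Encodable.encode (wordOf k i) < t) :
    (tableAux ((List.range t).map fun i => φ (queryWord i)) k m).isSome := by
  induction m with
  | zero => rfl
  | succ m ih =>
    obtain ⟨L, hL⟩ := Option.isSome_iff_exists.1 (ih fun i hi => h i (by omega))
    simp [tableAux, hL, answer_gathered_of_lt φ (h m (by omega))]

/-- Replacing a negative numerator by `0` only improves the approximation, since `u ≥ 0`. -/
theorem realApprox_of_isRealName {p : ℕ → Bool} {u : I} {a : ℕ → ℤ} (hp : EncodesSeq p a)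
    (ha : DyadicApprox a u) {t k A : ℕ} (h : realApprox ((List.range t).map p) k = some A) :
    |(u : ℝ) - A / 2 ^ (k + 1)| ≤ (2 ^ k : ℝ)⁻¹ := by
  simp only [realApprox, Option.map_eq_some_iff] at h
  obtain ⟨w, hw, rfl⟩ := h
  have hpre : (List.range t).map p <+: seqCode a (max t (k + 1)) := by
    have hl := le_length_seqCode a (max t (k + 1))
    rw [hp (max t (k + 1)), List.prefix_iff_eq_take, ← List.map_take, List.take_range]
    congr 2
    simp
    omega
  have h2 := scan_mono hpre
  rw [scan_seqCode] at h2
  obtain ⟨hk, rfl⟩ := List.getElem?_eq_some_iff.1 hw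
  rw [h2.getElem hk, List.getElem_map, List.getElem_range, binNat_bin]
  have h4 := ha k
  rcases le_total 0 (a k) with h0 | h0
  · have : (((a k).toNat : ℤ) : ℝ) = (a k : ℝ) := by rw [Int.toNat_of_nonneg h0]
    rw [Int.cast_natCast] at this
    rwa [this]
  · rw [Int.toNat_of_nonpos h0]
    have hu : (0 : ℝ) ≤ u := u.2.1
    have h5 : (a k : ℝ) / 2 ^ (k + 1) ≤ 0 :=
      div_nonpos_of_nonpos_of_nonneg (by exact_mod_cast h0) (by positivity)
    rw [Nat.cast_zero, zero_div, sub_zero, abs_of_nonneg hu]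
    linarith [(abs_le.1 h4).2]

theorem isSome_realApprox {p : ℕ → Bool} {a : ℕ → ℤ} (hp : EncodesSeq p a) {t k : ℕ}
    (h : (seqCode a (k + 1)).length ≤ t) : (realApprox ((List.range t).map p) k).isSome := by
  have h2 := scan_mono (hp.prefix_of_length_le h)
  rw [scan_seqCode] at h2
  have h3 : k < (scan ((List.range t).map p)).length := by
    have := h2.length_le
    simp at this
    omega
  simp [realApprox, List.getElem?_eq_getElem h3]

/-- Two errors of at most `2⁻⁽ⁿ⁺¹⁾` each. The given one is so small because `2 ^ k = 8 * 2 ^ (l + B)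
* 2 ^ (n + 1)` and `1 + l + B ≤ 2 ^ (l + B)`. The other comes from the two floor divisions, whose
errors both lie in `[0, 1]` and are subtracted. -/
theorem tableResult_error {x : ℝ} {n k A A' : ℕ} {L : List (ℕ × ℕ)} {l B : ℕ}
    (hk : k = n + l + B + 4)
    (h : |x - (((E (k, min A A', max A A', L)).1 : ℝ) - (E (k, min A A', max A A', L)).2) /
      2 ^ (2 * k + 1)| ≤ 8 * (1 + l + B) * (2 ^ k : ℝ)⁻¹) :
    |x - (((tableResult E n k A A' L).1 : ℝ) - (tableResult E n k A A' L).2) / 2 ^ (n + 1)| ≤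
      (2 ^ n : ℝ)⁻¹ := by
  unfold tableResult
  generalize E (k, min A A', max A A', L) = z at h ⊢
  have hround : ∀ y e : ℕ, ((y / 2 ^ e : ℕ) : ℝ) ≤ y / 2 ^ e ∧
      (y : ℝ) / 2 ^ e ≤ ((y / 2 ^ e : ℕ) : ℝ) + 1 := fun y e => by
    have h1 := Nat.div_mul_le_self y (2 ^ e)
    have h2 := Nat.lt_div_mul_add (a := y) (b := 2 ^ e) (by positivity)
    constructor
    · rw [le_div_iff₀ (by positivity)]
      exact_mod_cast h1
    · rw [div_le_iff₀ (by positivity)]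
      exact_mod_cast (by linarith : y ≤ (y / 2 ^ e + 1) * 2 ^ e)
  obtain ⟨h1, h1'⟩ := hround z.1 (2 * k - n)
  obtain ⟨h2, h2'⟩ := hround z.2 (2 * k - n)
  simp only
  generalize ((z.1 / 2 ^ (2 * k - n) : ℕ) : ℝ) = y₁ at *
  generalize ((z.2 / 2 ^ (2 * k - n) : ℕ) : ℝ) = y₂ at *
  have e1 : (2 : ℝ) ^ (2 * k + 1) = 2 ^ (2 * k - n) * 2 ^ (n + 1) := by
    rw [← pow_add]; congr 1; omega
  rw [e1, ← div_div, sub_div] at h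
  have h3 : 8 * (1 + l + B) * (2 ^ k : ℝ)⁻¹ ≤ (2 ^ (n + 1) : ℝ)⁻¹ := by
    have h4 : (1 + l + B : ℝ) ≤ 2 ^ (l + B) := by
      have := Nat.lt_two_pow_self (n := l + B)
      exact_mod_cast (by omega : 1 + l + B ≤ 2 ^ (l + B))
    have e2 : (2 : ℝ) ^ k = 8 * 2 ^ (l + B) * 2 ^ (n + 1) := by
      rw [hk]; ring
    rw [e2, mul_inv, ← mul_assoc]
    refine mul_le_of_le_one_left (by positivity) ?_
    rw [← div_eq_mul_inv, div_le_one (by positivity)]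
    linarith
  have e3 : (2 ^ n : ℝ)⁻¹ = (2 ^ (n + 1) : ℝ)⁻¹ + (2 ^ (n + 1) : ℝ)⁻¹ := by
    rw [pow_succ]; field_simp; norm_num
  have h5 : |((z.1 : ℝ) / 2 ^ (2 * k - n) - z.2 / 2 ^ (2 * k - n)) / 2 ^ (n + 1) -
      (y₁ - y₂) / 2 ^ (n + 1)| ≤ (2 ^ (n + 1) : ℝ)⁻¹ := by
    rw [← sub_div, abs_div, abs_of_pos (by positivity : (0 : ℝ) < 2 ^ (n + 1)), ← one_div]
    gcongr
    exact abs_le.2 ⟨by linarith, by linarith⟩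
  rw [e3]
  exact (abs_sub_le _ _ _).trans (add_le_add (h.trans h3) h5)

/-- An operator on Lipschitz functions is computable if its values can be approximated by a primitive
recursive function of a table of approximate function values. -/
theorem computableOperator_of_table {op : (I → ℝ) → I → I → ℝ} (hE : Primrec E)
    (h : ∀ (f : I → ℝ) (l B : ℕ), LipschitzWith l f → (∀ x, |f x| ≤ 1 + l + B) →
      ∀ (k : ℕ) (u v : I) (A A' : ℕ) (z : ℕ → ℕ × ℕ),
        |(u : ℝ) - A / 2 ^ (k + 1)| ≤ (2 ^ k : ℝ)⁻¹ →
        |(v : ℝ) - A' / 2 ^ (k + 1)| ≤ (2 ^ k : ℝ)⁻¹ →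
        (∀ i < 2 ^ k, |(((z i).1 : ℝ) - (z i).2) / 2 ^ (k + 1) -
          IccExtend zero_le_one f ((i : ℝ) / 2 ^ k)| ≤ (1 + l) * (2 ^ k : ℝ)⁻¹) →
        |op f u v - (((E (k, min A A', max A A', (List.range (2 ^ k)).map z)).1 : ℝ) -
          (E (k, min A A', max A A', (List.range (2 ^ k)).map z)).2) / 2 ^ (2 * k + 1)| ≤
            8 * (1 + l + B) * (2 ^ k : ℝ)⁻¹) :
    ComputableOperator LipFun op := by
  refine computableOperator_of_approx (primrec_tableApprox hE) ?_ ?_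
  · rintro f - u v φ p q ⟨l, ψ, hl, ⟨-, hψ⟩, hφ⟩ ⟨a, hp, ha⟩ ⟨b, hq, hb⟩ n t z hz
    simp only [tableApprox, approxAt, approxFromFirst, approxFromTable, gathered, Option.mem_def, Option.bind_eq_some_iff,
      Option.map_eq_some_iff] at hz
    obtain ⟨r, hr, A, hA, A', hA', L, hL, rfl⟩ := hz
    have hr' := answer_gathered hr
    have hL' := tableAux_gathered hL
    set k := precision n r with hk
    have hk' : k = n + l + natVal (ψ []).tail + 4 := by
      rw [hk, hr', hφ, precision, firstWord_pairWord, secondWord_pairWord, natVal_bin]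
    refine tableResult_error hk' ?_
    rw [hL']
    refine h f l _ hl ?_ k u v A A' _ (realApprox_of_isRealName hp ha hA)
      (realApprox_of_isRealName hq hb hA') ?_
    -- The answer to the empty word bounds `|f y|` at one point by `B / 2 + 1`; the Lipschitz
    -- constant carries this across an interval of length `1`.
    · intro x
      obtain ⟨y, -, hy⟩ := hψ []
      have h1 := hl.dist_le_mul x y
      rw [Real.dist_eq] at h1
      have h2 : dist x y ≤ 1 := Real.dist_le_of_mem_Icc_01 x.2 y.2
      have h3 : |f x - f y| ≤ l := h1.trans (by
        simpa using mul_le_mul_of_nonneg_left h2 (Nat.cast_nonneg (α := ℝ) l))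
      have h4 : (natVal (ψ []).tail : ℝ) = |(intVal (ψ []) : ℝ)| := by
        exact_mod_cast natVal_tail_eq (ψ [])
      rw [h4]
      simp only [List.length_nil, pow_zero, zero_add, pow_one, inv_one] at hy
      have h5 : |f y| ≤ |(intVal (ψ []) : ℝ)| / 2 + 1 := by
        have := abs_sub_abs_le_abs_sub (f y) ((intVal (ψ []) : ℝ) / 2)
        rw [abs_sub_comm] at hy
        rw [abs_div, abs_two] at this
        linarith
      have h6 := abs_sub_abs_le_abs_sub (f x) (f y)
      have h7 := abs_nonneg (intVal (ψ []) : ℝ)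
      linarith
    -- The name errs by `2⁻ᵏ` in the value, and by less than `2⁻ᵏ` in the argument, which costs
    -- another `l * 2⁻ᵏ`.
    · intro i hi
      obtain ⟨y, hy, hy'⟩ := hψ (wordOf k i)
      rw [natVal_wordOf hi, length_wordOf] at hy
      rw [length_wordOf] at hy'
      simp only [hφ, secondWord_pairWord]
      have h1 : (((intPair (ψ (wordOf k i))).1 : ℝ) - (intPair (ψ (wordOf k i))).2) =
          intVal (ψ (wordOf k i)) := by exact_mod_cast intPair_spec (ψ (wordOf k i))
      rw [h1]
      have hi' : (i : ℝ) / 2 ^ k ∈ Icc (0 : ℝ) 1 := ⟨by positivity, by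
        rw [div_le_one (by positivity)]; exact_mod_cast hi.le⟩
      rw [IccExtend_of_mem _ _ hi']
      have h2 := hl.dist_le_mul y ⟨_, hi'⟩
      rw [Real.dist_eq, Subtype.dist_eq, Real.dist_eq] at h2
      have h3 : |f y - f ⟨_, hi'⟩| ≤ l * (2 ^ k : ℝ)⁻¹ := h2.trans (by
        simpa using mul_le_mul_of_nonneg_left hy.le (Nat.cast_nonneg (α := ℝ) l))
      refine (abs_sub_le _ (f y) _).trans ?_
      linarith
  · rintro f - u v φ p q - ⟨a, hp, -⟩ ⟨b, hq, -⟩ n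
    set k := precision n (φ []) with hk
    obtain ⟨m, hm⟩ : ∃ m, ∀ i < 2 ^ k, Encodable.encode (wordOf k i) < m :=
      ⟨(Finset.range (2 ^ k)).sup (fun i => Encodable.encode (wordOf k i)) + 1, fun i hi =>
        Nat.lt_succ_of_le (Finset.le_sup (f := fun i => Encodable.encode (wordOf k i))
          (Finset.mem_range.2 hi))⟩
    refine ⟨m + (seqCode a (k + 1)).length + (seqCode b (k + 1)).length + 1, fun t ht => ?_⟩
    have h0 : answer ((List.range t).map fun i => φ (queryWord i)) [] = some (φ []) :=
      answer_gathered_of_lt φ (by rw [Encodable.encode_list_nil]; omega)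
    obtain ⟨A, hA⟩ := Option.isSome_iff_exists.1 (isSome_realApprox hp (t := t) (k := k) (by omega))
    obtain ⟨A', hA'⟩ := Option.isSome_iff_exists.1
      (isSome_realApprox hq (t := t) (k := k) (by omega))
    obtain ⟨L, hL⟩ := Option.isSome_iff_exists.1
      (isSome_tableAux_gathered φ (t := t) (k := k) (m := 2 ^ k)
        fun i hi => (hm i hi).trans_le (by omega))
    simp [tableApprox, approxAt, approxFromFirst, approxFromTable, gathered, h0, ← hk, hA, hA', hL]

end Table

/-! ## Maximization -/

/-- The value of a pair of natural numbers as an integer. -/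
def pairVal (z : ℕ × ℕ) : ℤ := (z.1 : ℤ) - z.2

/-- The maximum of `acc` and the entries `z i`, `i ∈ is`, with `lo ≤ 2 i + 4` and `2 i ≤ hi + 4`. -/
def maxFold (lo hi : ℕ) (z : ℕ → ℕ × ℕ) (is : List ℕ) (acc : ℕ × ℕ) : ℕ × ℕ :=
  is.foldl (fun acc i => if lo ≤ 2 * i + 4 ∧ 2 * i ≤ hi + 4 ∧ acc.1 + (z i).2 < (z i).1 + acc.2
    then z i else acc) acc

/-- The slack `4`, in units of half a cell, is `2` for the error of an endpoint and `2` for the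
distance from a point to its grid point. So no relevant index is missed, while all admitted ones
stay within three cells of the interval. -/
theorem maxFold_spec (lo hi : ℕ) (z : ℕ → ℕ × ℕ) (is : List ℕ) (acc : ℕ × ℕ) :
    (maxFold lo hi z is acc = acc ∨
      ∃ i ∈ is, lo ≤ 2 * i + 4 ∧ 2 * i ≤ hi + 4 ∧ maxFold lo hi z is acc = z i) ∧
    pairVal acc ≤ pairVal (maxFold lo hi z is acc) ∧
    ∀ i ∈ is, lo ≤ 2 * i + 4 → 2 * i ≤ hi + 4 →
      pairVal (z i) ≤ pairVal (maxFold lo hi z is acc) := by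
  induction is generalizing acc with
  | nil => simp [maxFold]
  | cons j is ih =>
    by_cases h : lo ≤ 2 * j + 4 ∧ 2 * j ≤ hi + 4 ∧ acc.1 + (z j).2 < (z j).1 + acc.2
    · have e : maxFold lo hi z (j :: is) acc = maxFold lo hi z is (z j) := by
        simp only [maxFold, List.foldl_cons, if_pos h]
      rw [e]
      obtain ⟨h1, h2, h3⟩ := ih (z j)
      refine ⟨Or.inr ?_, ?_, ?_⟩
      · rcases h1 with h1 | ⟨i, hi, h1⟩
        · exact ⟨j, by simp, h.1, h.2.1, h1⟩
        · exact ⟨i, by simp [hi], h1⟩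
      · refine le_trans ?_ h2
        unfold pairVal
        omega
      · intro i hi hi1 hi2
        rcases List.mem_cons.1 hi with rfl | hi
        · exact h2
        · exact h3 i hi hi1 hi2
    · have e : maxFold lo hi z (j :: is) acc = maxFold lo hi z is acc := by
        simp only [maxFold, List.foldl_cons, if_neg h]
      rw [e]
      obtain ⟨h1, h2, h3⟩ := ih acc
      refine ⟨?_, h2, ?_⟩
      · rcases h1 with h1 | ⟨i, hi, h1⟩
        · exact Or.inl h1
        · exact Or.inr ⟨i, by simp [hi], h1⟩
      · intro i hi hi1 hi2
        rcases List.mem_cons.1 hi with rfl | hi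
        · refine le_trans ?_ h2
          unfold pairVal
          omega
        · exact h3 i hi hi1 hi2

/-- The maximum of a table. -/
def maxTable (x : ℕ × ℕ × ℕ × List (ℕ × ℕ)) : ℕ × ℕ :=
  -- The fold starts from a genuine entry near the lower endpoint, since starting from `0` would
  -- spoil negative maxima. The final factor `2 ^ k` adapts the result to the denominator `2 ^ (2 *
  -- k + 1)` shared with integration.
  let y := maxFold x.2.1 x.2.2.1 (fun i => x.2.2.2.getD i (0, 0)) (List.range (2 ^ x.1))
    (x.2.2.2.getD (min (x.2.1 / 2) (2 ^ x.1 - 1)) (0, 0))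
  (y.1 * 2 ^ x.1, y.2 * 2 ^ x.1)

theorem primrec_maxTable : Primrec maxTable := by
  have hlo : Primrec fun x : ℕ × ℕ × ℕ × List (ℕ × ℕ) => x.2.1 := Primrec.fst.comp Primrec.snd
  have h2 : Primrec fun x : ℕ × ℕ × ℕ × List (ℕ × ℕ) => x.2.2 := Primrec.snd.comp Primrec.snd
  have hhi : Primrec fun x : ℕ × ℕ × ℕ × List (ℕ × ℕ) => x.2.2.1 := Primrec.fst.comp h2
  have hL : Primrec fun x : ℕ × ℕ × ℕ × List (ℕ × ℕ) => x.2.2.2 := Primrec.snd.comp h2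
  have hpow : Primrec fun x : ℕ × ℕ × ℕ × List (ℕ × ℕ) => 2 ^ x.1 :=
    primrec_pow.comp (Primrec.const 2) Primrec.fst
  have hi : Primrec fun y : (ℕ × ℕ × ℕ × List (ℕ × ℕ)) × ((ℕ × ℕ) × ℕ) => y.2.2 :=
    Primrec.snd.comp Primrec.snd
  have hacc : Primrec fun y : (ℕ × ℕ × ℕ × List (ℕ × ℕ)) × ((ℕ × ℕ) × ℕ) => y.2.1 :=
    Primrec.fst.comp Primrec.snd
  have h2i : Primrec fun y : (ℕ × ℕ × ℕ × List (ℕ × ℕ)) × ((ℕ × ℕ) × ℕ) => 2 * y.2.2 :=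
    Primrec.nat_mul.comp (Primrec.const 2) hi
  have hz : Primrec fun y : (ℕ × ℕ × ℕ × List (ℕ × ℕ)) × ((ℕ × ℕ) × ℕ) =>
      y.1.2.2.2.getD y.2.2 (0, 0) := (Primrec.list_getD (0, 0)).comp (hL.comp Primrec.fst) hi
  have hcond : PrimrecPred fun y : (ℕ × ℕ × ℕ × List (ℕ × ℕ)) × ((ℕ × ℕ) × ℕ) =>
      y.1.2.1 ≤ 2 * y.2.2 + 4 ∧ 2 * y.2.2 ≤ y.1.2.2.1 + 4 ∧
        y.2.1.1 + (y.1.2.2.2.getD y.2.2 (0, 0)).2 < (y.1.2.2.2.getD y.2.2 (0, 0)).1 + y.2.1.2 := by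
    refine PrimrecPred.and ?_ (PrimrecPred.and ?_ ?_)
    · exact Primrec.nat_le.comp (hlo.comp Primrec.fst) (Primrec.nat_add.comp h2i (Primrec.const 4))
    · exact Primrec.nat_le.comp h2i (Primrec.nat_add.comp (hhi.comp Primrec.fst) (Primrec.const 4))
    · exact Primrec.nat_lt.comp (Primrec.nat_add.comp (Primrec.fst.comp hacc) (Primrec.snd.comp hz))
        (Primrec.nat_add.comp (Primrec.fst.comp hz) (Primrec.snd.comp hacc))
  have hinit : Primrec fun x : ℕ × ℕ × ℕ × List (ℕ × ℕ) =>
      x.2.2.2.getD (min (x.2.1 / 2) (2 ^ x.1 - 1)) (0, 0) :=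
    (Primrec.list_getD (0, 0)).comp hL (Primrec.nat_min.comp
      (Primrec.nat_div.comp hlo (Primrec.const 2)) (Primrec.nat_sub.comp hpow (Primrec.const 1)))
  have hfold : Primrec fun x : ℕ × ℕ × ℕ × List (ℕ × ℕ) =>
      maxFold x.2.1 x.2.2.1 (fun i => x.2.2.2.getD i (0, 0)) (List.range (2 ^ x.1))
        (x.2.2.2.getD (min (x.2.1 / 2) (2 ^ x.1 - 1)) (0, 0)) :=
    Primrec.list_foldl (Primrec.list_range.comp hpow) hinit (Primrec.ite hcond hz hacc).to₂
  exact Primrec.pair (Primrec.nat_mul.comp (Primrec.fst.comp hfold) hpow)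
    (Primrec.nat_mul.comp (Primrec.snd.comp hfold) hpow)

theorem getD_map_range (z : ℕ → ℕ × ℕ) {m i : ℕ} (h : i < m) :
    ((List.range m).map z).getD i (0, 0) = z i := by
  rw [List.getD_eq_getElem _ _ (by simpa using h)]
  simp

theorem lipschitzWith_IccExtend {f : I → ℝ} {l : ℕ} (hf : LipschitzWith l f) (x y : ℝ) :
    |IccExtend zero_le_one f x - IccExtend zero_le_one f y| ≤ l * |x - y| := by
  have := (hf.comp (LipschitzWith.projIcc zero_le_one)).dist_le_mul x y
  simpa [Real.dist_eq, IccExtend] using this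

theorem abs_min_sub_le {u v x y ε : ℝ} (h : |u - x| ≤ ε) (h' : |v - y| ≤ ε) :
    |min u v - min x y| ≤ ε :=
  (abs_min_sub_min_le_max _ _ _ _).trans (max_le h h')

theorem abs_max_sub_le {u v x y ε : ℝ} (h : |u - x| ≤ ε) (h' : |v - y| ≤ ε) :
    |max u v - max x y| ≤ ε :=
  (abs_max_sub_max_le_max _ _ _ _).trans (max_le h h')

theorem natCast_min_div (A A' : ℕ) {D : ℝ} (hD : 0 < D) :
    ((min A A' : ℕ) : ℝ) / D = min (A / D) (A' / D) := by
  rw [Nat.cast_min, min_div_div_right hD.le]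

theorem natCast_max_div (A A' : ℕ) {D : ℝ} (hD : 0 < D) :
    ((max A A' : ℕ) : ℝ) / D = max (A / D) (A' / D) := by
  rw [Nat.cast_max, max_div_div_right hD.le]

theorem computableOperator_parMax : ComputableOperator LipFun parMax := by
  refine computableOperator_of_table primrec_maxTable ?_
  intro f l B hf hB k u v A A' z hA hA' hz
  set F := IccExtend zero_le_one f with hF
  have hFL : ∀ x y, |F x - F y| ≤ l * |x - y| := lipschitzWith_IccExtend hf
  set lo := min A A' with hlo
  set hi := max A A' with hhi
  have hD : (0 : ℝ) < 2 ^ (k + 1) := by positivity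
  have hK : (0 : ℝ) < 2 ^ k := by positivity
  set ε : ℝ := (2 ^ k : ℝ)⁻¹ with hε
  have hε0 : 0 < ε := by positivity
  have hpos : 0 < 2 ^ k := by positivity
  have hlo' : |min (u : ℝ) v - (lo : ℝ) * ε / 2| ≤ ε := by
    have := abs_min_sub_le hA hA'
    rwa [← natCast_min_div _ _ hD, pow_succ, ← div_div, div_eq_mul_inv (_ : ℝ) (2 ^ k)] at this
  have hhi' : |max (u : ℝ) v - (hi : ℝ) * ε / 2| ≤ ε := by
    have := abs_max_sub_le hA hA'
    rwa [← natCast_max_div _ _ hD, pow_succ, ← div_div, div_eq_mul_inv (_ : ℝ) (2 ^ k)] at this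
  have hu1 : max (u : ℝ) v ≤ 1 := max_le u.2.2 v.2.2
  have hu0 : 0 ≤ min (u : ℝ) v := le_min u.2.1 v.2.1
  have huv : min (u : ℝ) v ≤ max (u : ℝ) v := min_le_max
  have hKε : (2 ^ k : ℝ) * ε = 1 := mul_inv_cancel₀ hK.ne'
  have hlohi : lo ≤ hi := min_le_max
  set i₀ := min (lo / 2) (2 ^ k - 1) with hi₀
  set r := maxFold lo hi (fun i => ((List.range (2 ^ k)).map z).getD i (0, 0)) (List.range (2 ^ k))
    (((List.range (2 ^ k)).map z).getD i₀ (0, 0)) with hr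
  have hlo2 : lo ≤ 2 * 2 ^ k + 2 := by
    have h1 : (lo : ℝ) * ε ≤ (2 * 2 ^ k + 2) * ε := by
      rw [add_mul, mul_assoc, hKε]
      linarith [(abs_le.1 hlo').1]
    have h2 := le_of_mul_le_mul_right h1 hε0
    exact_mod_cast h2
  obtain ⟨h1, -, h3⟩ := maxFold_spec lo hi (fun i => ((List.range (2 ^ k)).map z).getD i (0, 0))
    (List.range (2 ^ k)) (((List.range (2 ^ k)).map z).getD i₀ (0, 0))
  rw [← hr] at h1 h3
  have hex : ∃ i < 2 ^ k, lo ≤ 2 * i + 4 ∧ 2 * i ≤ hi + 4 ∧ r = z i := by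
    rcases h1 with h1 | ⟨i, hi1, hi2, hi3, h1⟩
    · have : i₀ < 2 ^ k := by omega
      refine ⟨i₀, this, by omega, by omega, ?_⟩
      rwa [getD_map_range _ this] at h1
    · have hi1' := List.mem_range.1 hi1
      refine ⟨i, hi1', hi2, hi3, ?_⟩
      rwa [getD_map_range _ hi1'] at h1
  have hall : ∀ i < 2 ^ k, lo ≤ 2 * i + 4 → 2 * i ≤ hi + 4 → pairVal (z i) ≤ pairVal r := by
    intro i hi1 hi2 hi3
    have := h3 i (List.mem_range.2 hi1) hi2 hi3
    rwa [getD_map_range _ hi1] at this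
  have hval : (((maxTable (k, lo, hi, (List.range (2 ^ k)).map z)).1 : ℝ) -
      (maxTable (k, lo, hi, (List.range (2 ^ k)).map z)).2) / 2 ^ (2 * k + 1) =
      ((r.1 : ℝ) - r.2) / 2 ^ (k + 1) := by
    have : maxTable (k, lo, hi, (List.range (2 ^ k)).map z) = (r.1 * 2 ^ k, r.2 * 2 ^ k) := rfl
    rw [this]
    push_cast
    rw [← sub_mul, show 2 * k + 1 = (k + 1) + k by ring, pow_add _ (k + 1) k,
      mul_div_mul_right _ _ hK.ne']
  rw [hval]
  obtain ⟨⟨x, hx, hxM⟩, hmax⟩ := isGreatest_parMax hf.continuous u v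
  have hFI : ∀ x : I, F x = f x := fun x => IccExtend_val _ _ _
  have hcell : ∀ i : ℕ, (i : ℝ) / 2 ^ k = i * ε := fun i => div_eq_mul_inv _ _
  have hxl : min (u : ℝ) v ≤ x := hx.1
  have hxr : (x : ℝ) ≤ max (u : ℝ) v := hx.2
  have hl0 : (0 : ℝ) ≤ l := Nat.cast_nonneg l
  have hB0 : (0 : ℝ) ≤ B := Nat.cast_nonneg B
  refine abs_le.2 ⟨?_, ?_⟩
  · obtain ⟨i, hik, hi1, hi2, hri⟩ := hex
    have hz' := (abs_le.1 (hz i hik)).2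
    rw [hcell] at hz'
    have hi1' : (lo : ℝ) ≤ 2 * i + 4 := by exact_mod_cast hi1
    have hi2' : 2 * (i : ℝ) ≤ hi + 4 := by exact_mod_cast hi2
    have hik' : (i : ℝ) * ε ≤ 1 := by
      rw [← hKε]
      gcongr
      exact_mod_cast hik.le
    have hi0 : 0 ≤ (i : ℝ) * ε := by positivity
    have g1 : min (u : ℝ) v ≤ i * ε + 3 * ε := by
      nlinarith [(abs_le.1 hlo').2]
    have g2 : (i : ℝ) * ε ≤ max (u : ℝ) v + 3 * ε := by
      nlinarith [(abs_le.1 hhi').1]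
    -- The grid point of the selected entry may lie outside the interval; `y` is its projection, at
    -- most `3 * ε` away, and `f y` is bounded by the true maximum.
    let y : I := ⟨max (min (u : ℝ) v) (min (max (u : ℝ) v) (i * ε)),
      le_max_of_le_left hu0, max_le (huv.trans hu1) ((min_le_left _ _).trans hu1)⟩
    have hy1 : min (u : ℝ) v ≤ y := le_max_left _ _
    have hy2 : (y : ℝ) ≤ max (u : ℝ) v := max_le huv (min_le_left _ _)
    have hyd : |(i : ℝ) * ε - y| ≤ 3 * ε := by
      refine abs_le.2 ⟨?_, ?_⟩
      · have : (y : ℝ) ≤ i * ε + 3 * ε := max_le g1 ((min_le_right _ _).trans (by linarith))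
        linarith
      · have : (i : ℝ) * ε - 3 * ε ≤ y := le_max_of_le_right (le_min (by linarith) (by linarith))
        linarith
    have hyM := hmax ⟨y, ⟨hy1, hy2⟩, rfl⟩
    have h5 := (abs_le.1 (hFL (i * ε) y)).2
    rw [hFI] at h5
    have h6 : (l : ℝ) * |(i : ℝ) * ε - y| ≤ l * (3 * ε) := by gcongr
    rw [hri]
    nlinarith [mul_nonneg hB0 hε0.le, mul_nonneg hl0 hε0.le]
  -- Conversely, the grid point just below the maximizer `x` is admitted to the fold. The cap takes
  -- care of `x = 1`, which has no table entry.
  · set i := min ⌊(x : ℝ) * 2 ^ k⌋₊ (2 ^ k - 1) with hi'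
    have hik : i < 2 ^ k := by omega
    have hx0 : (0 : ℝ) ≤ x := x.2.1
    have hx1 : (x : ℝ) ≤ 1 := x.2.2
    have hxi : |(x : ℝ) - i * ε| ≤ ε := by
      have e : (x : ℝ) = x * 2 ^ k * ε := by rw [mul_assoc, hKε, mul_one]
      have hfl := Nat.floor_le (a := (x : ℝ) * 2 ^ k) (by positivity)
      have hfl' := Nat.lt_floor_add_one ((x : ℝ) * 2 ^ k)
      have hxk : (x : ℝ) * 2 ^ k ≤ 2 ^ k := mul_le_of_le_one_left hK.le hx1
      have hile : (i : ℝ) ≤ x * 2 ^ k := le_trans (Nat.cast_le.2 (min_le_left _ _)) hfl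
      have hige : (x : ℝ) * 2 ^ k ≤ i + 1 := by
        rcases le_total ⌊(x : ℝ) * 2 ^ k⌋₊ (2 ^ k - 1) with h | h
        · rw [hi', min_eq_left h]; exact hfl'.le
        · have : i + 1 = 2 ^ k := by omega
          have : (i : ℝ) + 1 = 2 ^ k := by exact_mod_cast this
          linarith
      rw [e, ← sub_mul, abs_mul, abs_of_pos hε0]
      exact mul_le_of_le_one_left hε0.le (abs_le.2 ⟨by linarith, by linarith⟩)
    have hi1 : lo ≤ 2 * i + 4 := by
      have h1 : (lo : ℝ) * ε ≤ (2 * i + 4) * ε := by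
        linarith [(abs_le.1 hlo').1, (abs_le.1 hxi).2]
      exact_mod_cast le_of_mul_le_mul_right h1 hε0
    have hi2 : 2 * i ≤ hi + 4 := by
      have h1 : (2 * i : ℝ) * ε ≤ (hi + 4) * ε := by
        linarith [(abs_le.1 hhi').2, (abs_le.1 hxi).1]
      exact_mod_cast le_of_mul_le_mul_right h1 hε0
    have h4 : ((z i).1 : ℝ) - (z i).2 ≤ (r.1 : ℝ) - r.2 := by
      have := hall i hik hi1 hi2
      unfold pairVal at this
      exact_mod_cast this
    have h4' : (((z i).1 : ℝ) - (z i).2) / 2 ^ (k + 1) ≤ ((r.1 : ℝ) - r.2) / 2 ^ (k + 1) := by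
      gcongr
    have hz' := (abs_le.1 (hz i hik)).1
    rw [hcell] at hz'
    have h5 := (abs_le.1 (hFL x (i * ε))).2
    rw [hFI, hxM] at h5
    have h6 : (l : ℝ) * |(x : ℝ) - i * ε| ≤ l * ε := by gcongr
    nlinarith [mul_nonneg hB0 hε0.le, mul_nonneg hl0 hε0.le]

/-! ## Integration -/

/-- The sum of the entries of a table with `lo ≤ 2 i < hi`. -/
def sumTable (x : ℕ × ℕ × ℕ × List (ℕ × ℕ)) : ℕ × ℕ :=
  (List.range (2 ^ x.1)).foldl (fun acc i => if x.2.1 ≤ 2 * i ∧ 2 * i < x.2.2.1 then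
    (acc.1 + (x.2.2.2.getD i (0, 0)).1, acc.2 + (x.2.2.2.getD i (0, 0)).2) else acc) (0, 0)

theorem primrec_sumTable : Primrec sumTable := by
  have h2 : Primrec fun x : ℕ × ℕ × ℕ × List (ℕ × ℕ) => x.2.2 := Primrec.snd.comp Primrec.snd
  have hi : Primrec fun y : (ℕ × ℕ × ℕ × List (ℕ × ℕ)) × ((ℕ × ℕ) × ℕ) => y.2.2 :=
    Primrec.snd.comp Primrec.snd
  have hacc : Primrec fun y : (ℕ × ℕ × ℕ × List (ℕ × ℕ)) × ((ℕ × ℕ) × ℕ) => y.2.1 :=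
    Primrec.fst.comp Primrec.snd
  have h2i : Primrec fun y : (ℕ × ℕ × ℕ × List (ℕ × ℕ)) × ((ℕ × ℕ) × ℕ) => 2 * y.2.2 :=
    Primrec.nat_mul.comp (Primrec.const 2) hi
  have hz : Primrec fun y : (ℕ × ℕ × ℕ × List (ℕ × ℕ)) × ((ℕ × ℕ) × ℕ) =>
      y.1.2.2.2.getD y.2.2 (0, 0) :=
    (Primrec.list_getD (0, 0)).comp ((Primrec.snd.comp h2).comp Primrec.fst) hi
  have hcond : PrimrecPred fun y : (ℕ × ℕ × ℕ × List (ℕ × ℕ)) × ((ℕ × ℕ) × ℕ) =>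
      y.1.2.1 ≤ 2 * y.2.2 ∧ 2 * y.2.2 < y.1.2.2.1 :=
    PrimrecPred.and (Primrec.nat_le.comp (Primrec.fst.comp (Primrec.snd.comp Primrec.fst)) h2i)
      (Primrec.nat_lt.comp h2i ((Primrec.fst.comp h2).comp Primrec.fst))
  exact Primrec.list_foldl
    (Primrec.list_range.comp (primrec_pow.comp (Primrec.const 2) Primrec.fst))
    (Primrec.const (0, 0)) (Primrec.ite hcond (Primrec.pair
      (Primrec.nat_add.comp (Primrec.fst.comp hacc) (Primrec.fst.comp hz))
      (Primrec.nat_add.comp (Primrec.snd.comp hacc) (Primrec.snd.comp hz))) hacc).to₂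

theorem foldl_sum_range (c : ℕ → Prop) [DecidablePred c] (z : ℕ → ℕ × ℕ) (m : ℕ) :
    (List.range m).foldl (fun acc i => if c i then (acc.1 + (z i).1, acc.2 + (z i).2) else acc)
      (0, 0) = (∑ i ∈ (Finset.range m).filter c, (z i).1,
        ∑ i ∈ (Finset.range m).filter c, (z i).2) := by
  induction m with
  | zero => rfl
  | succ m ih =>
    rw [List.range_succ, List.foldl_append, ih, List.foldl_cons, List.foldl_nil,
      Finset.range_add_one, Finset.filter_insert]
    split_ifs
    · rw [Finset.sum_insert (by simp), Finset.sum_insert (by simp), add_comm, add_comm (∑ _ ∈ _, _)]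
    · rfl

/-- `(lo + 1) / 2` is the ceiling of `lo / 2`; as an interval of indices, the sum matches adjacent
integrals over cells. -/
theorem sumTable_map_range (k lo hi : ℕ) (z : ℕ → ℕ × ℕ) :
    ((sumTable (k, lo, hi, (List.range (2 ^ k)).map z)).1 : ℝ) -
        (sumTable (k, lo, hi, (List.range (2 ^ k)).map z)).2 =
      ∑ i ∈ Finset.Ico (min ((lo + 1) / 2) (2 ^ k)) (min ((hi + 1) / 2) (2 ^ k)),
        (((z i).1 : ℝ) - (z i).2) := by
  have e : (Finset.range (2 ^ k)).filter (fun i => lo ≤ 2 * i ∧ 2 * i < hi) =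
      Finset.Ico (min ((lo + 1) / 2) (2 ^ k)) (min ((hi + 1) / 2) (2 ^ k)) := by
    ext i
    simp only [Finset.mem_filter, Finset.mem_range, Finset.mem_Ico]
    omega
  have h := foldl_sum_range (fun i => lo ≤ 2 * i ∧ 2 * i < hi)
    (fun i => ((List.range (2 ^ k)).map z).getD i (0, 0)) (2 ^ k)
  unfold sumTable
  simp only
  rw [h, e]
  push_cast
  rw [← Finset.sum_sub_distrib]
  refine Finset.sum_congr rfl fun i hi => ?_
  rw [getD_map_range z (by have := (Finset.mem_Ico.1 hi).2; omega)]

/-- The error `(1 + l) * ε` of the entry and the variation `l * ε` of `F` within the cell, times the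
width `ε`. -/
theorem abs_integral_cell_sub_le {F : ℝ → ℝ} {l ε y : ℝ} (hl : 0 ≤ l) (hε : 0 ≤ ε) {i : ℕ}
    (hF : ∀ x y, |F x - F y| ≤ l * |x - y|) (hy : |y - F (i * ε)| ≤ (1 + l) * ε) :
    |(∫ x in (i * ε)..((i + 1 : ℕ) * ε), F x) - y * ε| ≤ (1 + 2 * l) * ε * ε := by
  have hc : Continuous F := by
    refine (LipschitzWith.of_dist_le_mul (K := ⟨l, hl⟩) fun x y => ?_).continuous
    rw [Real.dist_eq, Real.dist_eq]; exact hF x y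
  have e : ((i + 1 : ℕ) : ℝ) * ε - i * ε = ε := by push_cast; ring
  have e1 : y * ε = ∫ _ in (i * ε)..((i + 1 : ℕ) * ε), y := by
    rw [intervalIntegral.integral_const, e, smul_eq_mul, mul_comm]
  rw [e1, ← intervalIntegral.integral_sub (hc.intervalIntegrable _ _) (by simp), ← Real.norm_eq_abs]
  refine (intervalIntegral.norm_integral_le_of_norm_le_const (C := (1 + 2 * l) * ε)
    fun x hx => ?_).trans (by rw [e, abs_of_nonneg hε])
  rw [uIoc_of_le (by linarith)] at hx
  have h1 := hF x (i * ε)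
  have h2 : |x - i * ε| ≤ ε := by
    rw [abs_of_nonneg (by linarith [hx.1])]
    linarith [hx.2]
  have h3 : l * |x - i * ε| ≤ l * ε := by gcongr
  rw [Real.norm_eq_abs]
  calc |F x - y| ≤ |F x - F (i * ε)| + |F (i * ε) - y| := abs_sub_le _ _ _
    _ ≤ _ := by rw [abs_sub_comm (F _) y]; linarith

theorem computableOperator_parInt : ComputableOperator LipFun parInt := by
  refine computableOperator_of_table primrec_sumTable ?_
  intro f l B hf hB k u v A A' z hA hA' hz
  unfold parInt
  set F := IccExtend zero_le_one f with hF
  have hFL : ∀ x y, |F x - F y| ≤ l * |x - y| := lipschitzWith_IccExtend hf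
  have hFB : ∀ x, |F x| ≤ 1 + l + B := fun x => hB _
  have hFc : Continuous F := hf.continuous.Icc_extend'
  rw [sumTable_map_range]
  have hD : (0 : ℝ) < 2 ^ (k + 1) := by positivity
  have hK : (0 : ℝ) < 2 ^ k := by positivity
  set ε : ℝ := (2 ^ k : ℝ)⁻¹ with hε
  have hε0 : 0 < ε := by positivity
  have hKε : (2 ^ k : ℝ) * ε = 1 := mul_inv_cancel₀ hK.ne'
  have hl0 : (0 : ℝ) ≤ l := Nat.cast_nonneg l
  have hB0 : (0 : ℝ) ≤ B := Nat.cast_nonneg B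
  -- Moving an endpoint to the grid costs `ε` for its approximation and at most `ε / 2` for the
  -- ceiling. Capping at `2 ^ k`, that is at the point `1`, does no harm because `x ≤ 1`.
  have hround : ∀ (x : ℝ) (m : ℕ), x ≤ 1 → |x - m * ε / 2| ≤ ε →
      |x - (min ((m + 1) / 2) (2 ^ k) : ℕ) * ε| ≤ 2 * ε := by
    intro x m hx hm
    have h1 : (m : ℝ) ≤ 2 * ((m + 1) / 2 : ℕ) := by
      exact_mod_cast (by omega : m ≤ 2 * ((m + 1) / 2))
    have h2 : 2 * (((m + 1) / 2 : ℕ) : ℝ) ≤ m + 1 := by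
      exact_mod_cast (by omega : 2 * ((m + 1) / 2) ≤ m + 1)
    obtain ⟨h3, h4⟩ := abs_le.1 hm
    rcases le_total ((m + 1) / 2) (2 ^ k) with h | h
    · rw [min_eq_left h]
      exact abs_le.2 ⟨by nlinarith, by nlinarith⟩
    · rw [min_eq_right h]
      have h5 : (2 ^ k : ℝ) ≤ ((m + 1) / 2 : ℕ) := by exact_mod_cast h
      push_cast
      rw [hKε]
      exact abs_le.2 ⟨by nlinarith, by linarith⟩
  have hlo' : |min (u : ℝ) v - ((min A A' : ℕ) : ℝ) * ε / 2| ≤ ε := by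
    have := abs_min_sub_le hA hA'
    rwa [← natCast_min_div _ _ hD, pow_succ, ← div_div, div_eq_mul_inv (_ : ℝ) (2 ^ k)] at this
  have hhi' : |max (u : ℝ) v - ((max A A' : ℕ) : ℝ) * ε / 2| ≤ ε := by
    have := abs_max_sub_le hA hA'
    rwa [← natCast_max_div _ _ hD, pow_succ, ← div_div, div_eq_mul_inv (_ : ℝ) (2 ^ k)] at this
  have hlo := hround _ _ (min_le_max.trans (max_le u.2.2 v.2.2)) hlo'
  have hhi := hround _ _ (max_le u.2.2 v.2.2) hhi'
  set j := min ((min A A' + 1) / 2) (2 ^ k) with hj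
  set j' := min ((max A A' + 1) / 2) (2 ^ k) with hj'
  have hjj : j ≤ j' := by
    have : min A A' ≤ max A A' := min_le_max
    omega
  -- At most `2 ^ k` cells contribute `(1 + 2 * l) * ε * ε` each, and `2 ^ k * ε = 1`.
  have hsum : |(∫ x in (j * ε)..(j' * ε), F x) -
      (∑ i ∈ Finset.Ico j j', (((z i).1 : ℝ) - (z i).2)) / 2 ^ (2 * k + 1)| ≤
      (1 + 2 * l) * ε := by
    rw [← intervalIntegral.sum_integral_adjacent_intervals_Ico (a := fun i : ℕ => (i : ℝ) * ε) hjj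
      (fun i _ => hFc.intervalIntegrable _ _), Finset.sum_div, ← Finset.sum_sub_distrib]
    refine (Finset.abs_sum_le_sum_abs _ _).trans ?_
    calc _ ≤ ∑ i ∈ Finset.Ico j j', (1 + 2 * l) * ε * ε := by
          refine Finset.sum_le_sum fun i hi => ?_
          have hik : i < 2 ^ k := by have := (Finset.mem_Ico.1 hi).2; omega
          have h1 := hz i hik
          rw [div_eq_mul_inv (i : ℝ)] at h1
          have h2 := abs_integral_cell_sub_le hl0 hε0.le hFL h1
          have e : (((z i).1 : ℝ) - (z i).2) / 2 ^ (2 * k + 1) =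
              (((z i).1 : ℝ) - (z i).2) / 2 ^ (k + 1) * ε := by
            rw [hε, ← div_eq_mul_inv, div_div, ← pow_add]
            congr 2
            ring
          rw [e]
          exact h2
      _ = (j' - j : ℕ) * ε * ((1 + 2 * l) * ε) := by
          rw [Finset.sum_const, Nat.card_Ico, nsmul_eq_mul]; ring
      _ ≤ 1 * ((1 + 2 * l) * ε) := by
          gcongr
          rw [← hKε]
          gcongr
          exact_mod_cast (Nat.sub_le j' j).trans (min_le_right _ (2 ^ k))
      _ = _ := one_mul _
  have hend : ∀ x y : ℝ, |x - y| ≤ 2 * ε → |∫ t in x..y, F t| ≤ (1 + l + B) * (2 * ε) := by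
    intro x y hxy
    rw [← Real.norm_eq_abs]
    refine (intervalIntegral.norm_integral_le_of_norm_le_const fun t _ => hFB t).trans ?_
    rw [abs_sub_comm]
    gcongr
  have hi : ∀ x y, IntervalIntegrable F volume x y := fun x y => hFc.intervalIntegrable x y
  have hsplit : (∫ x in min (u : ℝ) v..max (u : ℝ) v, F x) =
      (∫ x in min (u : ℝ) v..(j * ε), F x) + (∫ x in (j * ε)..(j' * ε), F x) -
        ∫ x in max (u : ℝ) v..(j' * ε), F x := by
    rw [intervalIntegral.integral_add_adjacent_intervals (hi _ _) (hi _ _),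
      eq_sub_iff_add_eq, intervalIntegral.integral_add_adjacent_intervals (hi _ _) (hi _ _)]
  have h1 := abs_le.1 hsum
  have h2 := abs_le.1 (hend _ _ hlo)
  have h3 := abs_le.1 (hend _ _ hhi)
  rw [hsplit]
  -- In total `(1 + 2l)ε` from the cells and `2(1 + l + B)ε` from each displaced endpoint, within
  -- the allowed `8(1 + l + B)ε`.
  refine abs_le.2 ⟨?_, ?_⟩ <;> nlinarith [mul_nonneg hB0 hε0.le, mul_nonneg hl0 hε0.le]

theorem mainTheorem6 :
    -- parametric maximization is computable on `Lip[0;1]`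
    ComputableOperator LipFun parMax ∧
    -- but not in subexponential time, even for analytic 1-Lipschitz functions `[0;1] → [0;1]`
    (∀ T : ℕ → (ℕ → ℕ) → ℕ, Subexponential T →
      ¬ ComputableOperatorInTime (LipOneUnit ∩ HolomorphicOn unitSegment) parMax T) ∧
    -- parametric integration is computable on `Lip[0;1]`
    ComputableOperator LipFun parInt ∧
    -- but not in subexponential time, even for 1-Lipschitz functions `[0;1] → [0;1]` that are
    -- analytic on the closed complex unit disc
    (∀ T : ℕ → (ℕ → ℕ) → ℕ, Subexponential T →
      ¬ ComputableOperatorInTime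
        (LipOneUnit ∩ HolomorphicOn (Metric.closedBall (0 : ℂ) 1)) parInt T) ∧
    -- modulus-of-continuity names do not reduce to Lipschitz-constant names
    ¬ ReducesTo LipFun IsModulusName IsLipName := by
  refine ⟨computableOperator_parMax, fun T hT => ?_, computableOperator_parInt, fun T hT => ?_,
    not_reducesTo_isModulusName_isLipName⟩
  · exact not_computableOperatorInTime inter_subset_left
      ⟨zero_mem_lipOneUnit, zero_mem_holomorphicOn _⟩ (parMax_zero 0 1) (fun N c hN _ =>
        ⟨⟨bump_mem_lipOneUnit hN c.2, bump_mem_holomorphicOn N c _⟩, le_parMax_bump hN c⟩) hT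
  · exact not_computableOperatorInTime inter_subset_left
      ⟨zero_mem_lipOneUnit, zero_mem_holomorphicOn _⟩ (parInt_zero 0 1) (fun N c hN hc =>
        ⟨⟨bump_mem_lipOneUnit hN c.2, bump_mem_holomorphicOn N c _⟩, le_parInt_bump hN c hc⟩) hT
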